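/- Let $\gamma\subset\mathbb R^2$ be an oval, that is, a $C^\infty$-smooth regular simple closed curve that is the boundary of a strictly convex compact region. For a point $P\in\mathbb R^2$ in the exterior of $\gamma$, let $f_P:\gamma\to\gamma$ be the involution given by the lines through $P$: $f_P(x)$ is the second intersection point of the line $Px$ with $\gamma$, and $f_P(x)=x$ if this line is tangent to $\gamma$. For two points $P,Q$ in the exterior of $\gamma$ put $F_{P,Q}=f_P\circ f_Q$. Suppose that for all pairs of distinct points $P,Q\in\mathbb R^2$ such that the line $PQ$ is disjoint from $\gamma$, the map $F_{P,Q}:\gamma\to\gamma$ is conjugate to a rotation, that is, there are a homeomorphism $h$ of $\gamma$ onto the unit circle $S^1$ and a rotation $R$ of $S^1$ with $h\circ F_{P,Q}=R\circ h$. Then $\gamma$ is an ellipse. -/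

import Mathlib

open scoped ContDiff

/-- The Euclidean plane. -/
abbrev Plane : Type := EuclideanSpace ℝ (Fin 2)

/-- `γ` is an oval: a smooth (`C^∞`, regularly parametrized) simple closed curve which is the
boundary of a strictly convex compact region. -/
structure IsOval (γ : Set Plane) : Prop where
  smooth : ∃ c : ℝ → Plane, ContDiff ℝ ∞ c ∧ Function.Periodic c 1 ∧
    Set.InjOn c (Set.Ico 0 1) ∧ (∀ t, deriv c t ≠ 0) ∧ Set.range c = γ
  strictlyConvex : ∃ K : Set Plane, IsCompact K ∧ StrictConvex ℝ K ∧ (interior K).Nonempty ∧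
    frontier K = γ

open Classical in
/-- The map `f_P : γ → γ` given by the lines through `P`: the point `x` goes to the other
intersection point of the line `Px` with `γ`, and `x` is fixed if there is none (the line is then
tangent to `γ`). A line meets an oval in at most two points, so for `P` outside the oval the chosen
point is the only one. -/
noncomputable def pencilMap (γ : Set Plane) (P : Plane) (x : γ) : γ :=
  if h : ∃ y : γ, y ≠ x ∧ (y : Plane) ∈ line[ℝ, P, (x : Plane)] then h.choose else x

/-- The circle map `F_{P,Q} = f_P ∘ f_Q`. -/
noncomputable def pencilComp (γ : Set Plane) (P Q : Plane) : γ → γ :=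
  pencilMap γ P ∘ pencilMap γ Q

/-- A self-map of a space is conjugate to a rotation if some homeomorphism of the space onto the
unit circle carries it to a rotation `z ↦ ρ * z`. -/
def IsConjugateToRotation {X : Type*} [TopologicalSpace X] (F : X → X) : Prop :=
  ∃ (h : X ≃ₜ Circle) (ρ : Circle), ∀ x, h (F x) = ρ * h x

/-- An ellipse is the image of the unit circle under an invertible affine map of the plane. -/
def IsEllipse (γ : Set Plane) : Prop :=
  ∃ A : Plane ≃ᵃ[ℝ] Plane, γ = A '' Metric.sphere (0 : Plane) 1

/-!
Three lines of thought combine.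

*Commutation.* Let the tangents at `a, b ∈ γ` meet in `Q`, the pole of the chord `ab`, and let `P`
be a point of the line `ab` outside the oval. The line `PQ` misses `γ`, the involution `f_Q` fixes
`a` and `b`, and `f_P` exchanges them. So `f_P ∘ f_Q` has an orbit of period two; being conjugate
to a rotation, it is an involution, and `f_P` commutes with `f_Q` (`IsPole.pencilMap_comm`).

*Harmonic chords.* In a chart that sends `Q` to infinity in the vertical direction and `ab` to a
horizontal segment, commutation for all `P` says that the two arcs cut off by `ab` are vertical
dilates of each other, by some factor `k` (`IsPole.ratio_eq`). Let `α`, `β`, `κ` be the equations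
of the tangents at `b` and `a` and of the line `ab`. If the curvature at `a` is not zero, then `κ²
/ (αβ)` has the same nonzero limit at `a` along both arcs, which forces `k = -1`: every chord
through `Q` is divided harmonically by `Q` and `ab` (`IsPole.harmonic`). Where the curvature
vanishes this argument says nothing, but the points of nonzero curvature are dense, because `γ`
contains no segment (`IsOvalParam.exists_nonflat`).

*The conic.* Fix a chord `ab` with pole `Q`. At a point `x ∈ γ` of nonzero curvature, with tangent
not parallel to `ab`, let `P` be the intersection of this tangent with `ab`. By commutation the
tangent at `f_Q x` passes through `P` as well, so that `P` is the pole of the chord joining `x`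
and `f_Q x`. The harmonic property of this chord, applied to the line `ab` through `P`, says that
the derivative of `κ² / (αβ)` along `γ` vanishes at `x` (`IsPole.log_deriv_eq_zero`). By density
it vanishes everywhere, so `κ² / (αβ)` is constant on each arc; if `a` has nonzero curvature, the
limit at `a` shows that both constants agree. So `γ` lies on the conic `κ² = L αβ`
(`IsOvalParam.exists_conic`), which is an ellipse because the ray from `Q` through the midpoint of
`ab` leaves the oval, and `γ` is the whole ellipse because it surrounds an interior point
(`IsPole.isEllipse`).
-/

/-! ### The wedge product and lines in the plane -/

/-- The determinant of two plane vectors. -/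
def wedge (u v : Plane) : ℝ := u 0 * v 1 - u 1 * v 0

theorem plane_ext {u v : Plane} (h0 : u 0 = v 0) (h1 : u 1 = v 1) : u = v := by
  ext i; fin_cases i
  · exact h0
  · exact h1

theorem wedge_add_right (u v w : Plane) : wedge u (v + w) = wedge u v + wedge u w := by
  simp only [wedge, PiLp.add_apply]; ring

theorem wedge_sub_right (u v w : Plane) : wedge u (v - w) = wedge u v - wedge u w := by
  simp only [wedge, PiLp.sub_apply]; ring

theorem wedge_smul_right (u v : Plane) (r : ℝ) : wedge u (r • v) = r * wedge u v := by
  simp only [wedge, PiLp.smul_apply, smul_eq_mul]; ring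

theorem wedge_smul_left (u v : Plane) (r : ℝ) : wedge (r • u) v = r * wedge u v := by
  simp only [wedge, PiLp.smul_apply, smul_eq_mul]; ring

theorem wedge_swap (u v : Plane) : wedge u v = -wedge v u := by
  simp only [wedge]; ring

theorem wedge_self_eq_zero (u : Plane) : wedge u u = 0 := by
  simp only [wedge]; ring

theorem exists_smul_of_wedge_eq_zero {u v : Plane} (hu : u ≠ 0) (h : wedge u v = 0) :
    ∃ r : ℝ, v = r • u := by
  have h' : u 0 * v 1 = u 1 * v 0 := by simpa [wedge, sub_eq_zero] using h
  by_cases h0 : u 0 = 0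
  · have h1 : u 1 ≠ 0 := fun h1 => hu (plane_ext (by simpa using h0) (by simpa using h1))
    refine ⟨v 1 / u 1, plane_ext ?_ ?_⟩
    · have : v 0 = 0 := by simpa [h0, h1] using h'.symm
      simp [h0, this]
    · simp [h1]
  · refine ⟨v 0 / u 0, plane_ext ?_ ?_⟩
    · simp [h0]
    · simp only [PiLp.smul_apply, smul_eq_mul]; field_simp; linarith

/-- Cramer's rule. -/
theorem exists_combination {u v : Plane} (h : wedge u v ≠ 0) (x : Plane) :
    ∃ r s : ℝ, x = r • u + s • v := by
  refine ⟨wedge x v / wedge u v, wedge u x / wedge u v, ?_⟩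
  apply plane_ext <;>
  · simp only [PiLp.add_apply, PiLp.smul_apply, smul_eq_mul]
    field_simp
    simp only [wedge]; ring

theorem mem_line_iff_exists {P x y : Plane} :
    y ∈ line[ℝ, P, x] ↔ ∃ r : ℝ, y = P + r • (x - P) := by
  constructor
  · intro h
    have h' : (y - P) +ᵥ P ∈ line[ℝ, P, x] := by simpa using h
    obtain ⟨r, hr⟩ := vadd_left_mem_affineSpan_pair.1 h'
    exact ⟨r, by rw [← vsub_eq_sub x P, hr]; abel⟩
  · rintro ⟨r, rfl⟩
    rw [add_comm]
    exact smul_vsub_vadd_mem_affineSpan_pair r P x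

theorem mem_line_iff {P x y : Plane} (h : P ≠ x) :
    y ∈ line[ℝ, P, x] ↔ wedge (x - P) (y - P) = 0 := by
  rw [mem_line_iff_exists]
  constructor
  · rintro ⟨r, rfl⟩
    rw [add_sub_cancel_left, wedge_smul_right, wedge_self_eq_zero, mul_zero]
  · intro hc
    obtain ⟨r, hr⟩ := exists_smul_of_wedge_eq_zero (sub_ne_zero.2 h.symm) hc
    exact ⟨r, by rw [← hr]; abel⟩

theorem hasDerivAt_wedge {f : ℝ → Plane} {f' : Plane} {t : ℝ} (hf : HasDerivAt f f' t)
    (T x : Plane) : HasDerivAt (fun s => wedge T (f s - x)) (wedge T f') t := by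
  have h := fun i => (PiLp.hasFDerivAt_apply (𝕜 := ℝ) 2 (f t) i).comp_hasDerivAt t hf
  have h0 := h 0
  have h1 := h 1
  exact (((h1.sub_const (x 1)).const_mul (T 0)).sub ((h0.sub_const (x 0)).const_mul (T 1)))

theorem continuous_wedge (T x : Plane) : Continuous fun y => wedge T (y - x) := by
  unfold wedge; fun_prop

/-! ### Strictly convex bodies in the plane -/

theorem mem_interior_of_between {K : Set Plane} (hs : StrictConvex ℝ K) {x y : Plane}
    (hx : x ∈ K) (hy : y ∈ K) (hxy : x ≠ y) {s : ℝ} (h0 : 0 < s) (h1 : s < 1) :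
    x + s • (y - x) ∈ interior K := by
  have := hs hx hy hxy (sub_pos.2 h1) h0 (by ring)
  convert this using 1
  module

theorem notMem_frontier_of_between {K : Set Plane} (hs : StrictConvex ℝ K) {x y : Plane}
    (hx : x ∈ K) (hy : y ∈ K) (hxy : x ≠ y) {s : ℝ} (h0 : 0 < s) (h1 : s < 1) :
    x + s • (y - x) ∉ frontier K :=
  fun h => h.2 (mem_interior_of_between hs hx hy hxy h0 h1)

/-- On a line, a boundary point of a strictly convex body does not lie between two of its points. -/
theorem false_of_three_params {K : Set Plane} (hs : StrictConvex ℝ K) {p v : Plane} (hv : v ≠ 0)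
    {r s t : ℝ} (hrs : r < s) (hst : s < t) (hr : p + r • v ∈ K) (ht : p + t • v ∈ K)
    (hm : p + s • v ∈ frontier K) : False := by
  have hrt : 0 < t - r := by linarith
  have hne : p + r • v ≠ p + t • v := by
    intro h
    have h2 : (t - r) • v = 0 := by rw [sub_smul, sub_eq_zero]; exact (add_left_cancel h).symm
    rcases smul_eq_zero.1 h2 with h | h
    · linarith
    · exact hv h
  refine notMem_frontier_of_between hs hr ht hne (s := (s - r) / (t - r)) (by
    apply div_pos <;> linarith) (by rw [div_lt_one hrt]; linarith) ?_
  convert hm using 1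
  have : s = r + (s - r) / (t - r) * (t - r) := by field_simp; ring
  conv_rhs => rw [this]
  module

/-- A line meets the boundary of a strictly convex body in at most two points. -/
theorem eq_or_eq_of_wedge_eq_zero {K : Set Plane} (hK : IsCompact K) (hs : StrictConvex ℝ K)
    {a b X : Plane} (ha : a ∈ frontier K) (hb : b ∈ frontier K) (hX : X ∈ frontier K)
    (hab : a ≠ b) (h0 : wedge (b - a) (X - a) = 0) : X = a ∨ X = b := by
  have hv := sub_ne_zero.2 hab.symm
  obtain ⟨r, hr⟩ := exists_smul_of_wedge_eq_zero hv h0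
  have hXr : X = a + r • (b - a) := by rw [← hr]; abel
  have e0 : a = a + (0 : ℝ) • (b - a) := by module
  have e1 : b = a + (1 : ℝ) • (b - a) := by module
  have hfr := hK.isClosed.frontier_subset
  rw [e0] at ha
  rw [e1] at hb
  rw [hXr] at hX
  by_contra! hne
  have hr0 : r ≠ 0 := by rintro rfl; exact hne.1 (hXr.trans e0.symm)
  have hr1 : r ≠ 1 := by rintro rfl; exact hne.2 (hXr.trans e1.symm)
  rcases lt_or_gt_of_ne hr0 with h2 | h2
  · exact false_of_three_params hs hv h2 one_pos (hfr hX) (hfr hb) ha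
  · rcases lt_or_gt_of_ne hr1 with h3 | h3
    · exact false_of_three_params hs hv h2 h3 (hfr ha) (hfr hb) hX
    · exact false_of_three_params hs hv one_pos h3 (hfr ha) (hfr hX) hb

theorem exists_pos_mem_frontier {K : Set Plane} (hK : IsCompact K) {z v : Plane}
    (hz : z ∈ interior K) (hv : v ≠ 0) : ∃ s : ℝ, 0 < s ∧ z + s • v ∈ frontier K := by
  let f : ℝ → Plane := fun s => z + s • v
  have hf : Continuous f := by fun_prop
  have hcl : IsClosed (Set.Ici (0 : ℝ) ∩ f ⁻¹' K) := isClosed_Ici.inter (hK.isClosed.preimage hf)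
  obtain ⟨R, hR⟩ := hK.isBounded.subset_closedBall z
  have hb : Set.Ici (0 : ℝ) ∩ f ⁻¹' K ⊆ Set.Icc 0 (R / ‖v‖) := by
    rintro s ⟨h0, h1⟩
    refine ⟨h0, ?_⟩
    have := hR h1
    rw [mem_closedBall_iff_norm, add_sub_cancel_left, norm_smul, Real.norm_of_nonneg h0] at this
    rwa [le_div_iff₀ (norm_pos_iff.2 hv)]
  have hcomp : IsCompact (Set.Ici (0 : ℝ) ∩ f ⁻¹' K) := isCompact_Icc.of_isClosed_subset hcl hb
  obtain ⟨s, ⟨hs0, hsK⟩, hmax⟩ := hcomp.exists_isGreatest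
    ⟨0, Set.mem_Ici.2 le_rfl, by simpa [f] using interior_subset hz⟩
  have hni : f s ∉ interior K := by
    intro hi
    have hn : ∀ᶠ u in nhds s, f u ∈ interior K :=
      hf.continuousAt.eventually (isOpen_interior.mem_nhds hi)
    obtain ⟨ε, hε, hball⟩ := Metric.eventually_nhds_iff.1 hn
    have h1 := hball (y := s + ε / 2) (by simp [abs_of_pos hε, hε])
    have := hmax ⟨by simp only [Set.mem_Ici] at hs0 ⊢; linarith, interior_subset (s := K) h1⟩
    linarith
  refine ⟨s, lt_of_le_of_ne hs0 ?_, subset_closure hsK, hni⟩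
  rintro rfl
  exact hni (by simpa [f] using hz)

/-! ### The involution of a pencil of lines -/

theorem pencil_unique {K : Set Plane} (hK : IsCompact K) (hs : StrictConvex ℝ K) {P : Plane}
    {x y z : frontier K} (hyx : y ≠ x) (hzx : z ≠ x)
    (hy : (y : Plane) ∈ line[ℝ, P, (x : Plane)]) (hz : (z : Plane) ∈ line[ℝ, P, (x : Plane)]) :
    y = z := by
  obtain ⟨r, hr⟩ := mem_line_iff_exists.1 hy
  obtain ⟨s, hs'⟩ := mem_line_iff_exists.1 hz
  have h0 : wedge ((x : Plane) - y) ((z : Plane) - y) = 0 := by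
    rw [hs', show P + s • ((x : Plane) - P) - y = (s - r) • ((x : Plane) - P) by rw [hr]; module,
      show (x : Plane) - y = (1 - r) • ((x : Plane) - P) by rw [hr]; module, wedge_smul_left,
      wedge_smul_right, wedge_self_eq_zero, mul_zero, mul_zero]
  rcases eq_or_eq_of_wedge_eq_zero hK hs y.2 x.2 z.2 (fun h => hyx (Subtype.ext h)) h0 with h | h
  · exact (Subtype.ext h).symm
  · exact (hzx (Subtype.ext h)).elim

section pencil

variable {K : Set Plane} (hK : IsCompact K) (hs : StrictConvex ℝ K) {P : Plane} (hP : P ∉ K)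
include hK hs hP

omit hP in
theorem pencilMap_eq {x y : frontier K} (hyx : y ≠ x)
    (hy : (y : Plane) ∈ line[ℝ, P, (x : Plane)]) : pencilMap (frontier K) P x = y := by
  have h : ∃ y : frontier K, y ≠ x ∧ (y : Plane) ∈ line[ℝ, P, (x : Plane)] := ⟨y, hyx, hy⟩
  rw [pencilMap, dif_pos h]
  exact pencil_unique hK hs h.choose_spec.1 hyx h.choose_spec.2 hy

omit hK hs hP in
theorem pencilMap_mem_line (x : frontier K) :
    (pencilMap (frontier K) P x : Plane) ∈ line[ℝ, P, (x : Plane)] := by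
  rw [pencilMap]
  split_ifs with h
  · exact h.choose_spec.2
  · exact right_mem_affineSpan_pair ℝ _ _

omit hs in
theorem ne_frontier (x : frontier K) : P ≠ x :=
  fun h => hP (h ▸ hK.isClosed.frontier_subset x.2)

omit hs in
theorem wedge_pencilMap (x : frontier K) :
    wedge ((x : Plane) - P) ((pencilMap (frontier K) P x : Plane) - P) = 0 :=
  (mem_line_iff (ne_frontier hK hP x)).1 (pencilMap_mem_line x)

theorem pencilMap_involutive : Function.Involutive (pencilMap (frontier K) P) := by
  intro x
  by_cases h : pencilMap (frontier K) P x = x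
  · rw [h, h]
  · refine pencilMap_eq hK hs (Ne.symm h) ?_
    rw [mem_line_iff (ne_frontier hK hP _), wedge_swap, wedge_pencilMap hK hP, neg_zero]

theorem pencilMap_eq_of_wedge {x y : frontier K} (hyx : y ≠ x)
    (hy : wedge ((x : Plane) - P) ((y : Plane) - P) = 0) : pencilMap (frontier K) P x = y :=
  pencilMap_eq hK hs hyx ((mem_line_iff (ne_frontier hK hP x)).2 hy)

end pencil

/-- If `F = f_P ∘ f_Q` is conjugate to a rotation and has an orbit of period two, then `F² = id`,
and so the two involutions commute. -/
theorem pencilMap_comm_of_orbit {K : Set Plane} (hK : IsCompact K) (hs : StrictConvex ℝ K)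
    {P Q : Plane} (hP : P ∉ K) (hQ : Q ∉ K)
    (hrot : IsConjugateToRotation (pencilComp (frontier K) P Q)) {a b : frontier K}
    (hQa : pencilMap (frontier K) Q a = a) (hQb : pencilMap (frontier K) Q b = b)
    (hPa : pencilMap (frontier K) P a = b) (x : frontier K) :
    pencilMap (frontier K) P (pencilMap (frontier K) Q x) =
      pencilMap (frontier K) Q (pencilMap (frontier K) P x) := by
  obtain ⟨h, ρ, hh⟩ := hrot
  have hiP := pencilMap_involutive hK hs hP
  have hiQ := pencilMap_involutive hK hs hQ
  have hPb : pencilMap (frontier K) P b = a := by rw [← hPa, hiP]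
  have ha : h b = ρ * h a := by rw [← hh a, pencilComp, Function.comp, hQa, hPa]
  have hb : h a = ρ * h b := by rw [← hh b, pencilComp, Function.comp, hQb, hPb]
  have hρ : ρ * ρ = 1 := by
    rw [ha, ← mul_assoc] at hb
    exact mul_eq_right.1 hb.symm
  have hF : pencilComp (frontier K) P Q (pencilComp (frontier K) P Q x) = x := by
    apply h.injective
    rw [hh, hh, ← mul_assoc, hρ, one_mul]
  have h2 := congrArg (pencilMap (frontier K) P) hF
  simp only [pencilComp, Function.comp, hiP _] at h2
  rw [← h2, hiQ]

/-! ### Tangent vectors of a strictly convex curve -/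

/-- `T` is a tangent vector at `x` of the strictly convex body `K`, oriented so that `K` lies to
its left: the body meets the line through `x` directed by `T` only in `x`. -/
def IsTangentVec (K : Set Plane) (x T : Plane) : Prop :=
  ∀ X ∈ K, X ≠ x → 0 < wedge T (X - x)

theorem IsTangentVec.nonneg {K : Set Plane} {x T : Plane} (h : IsTangentVec K x T) {X : Plane}
    (hX : X ∈ K) : 0 ≤ wedge T (X - x) := by
  by_cases hx : X = x
  · simp [hx, wedge]
  · exact (h X hX hx).le

/-- A strictly convex body `K` in the plane together with a regular parametrization `c`, of
period `1`, of its boundary. -/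
structure IsOvalParam (K : Set Plane) (c : ℝ → Plane) : Prop where
  isCompact : IsCompact K
  strictConvex : StrictConvex ℝ K
  nonempty : (interior K).Nonempty
  contDiff : ContDiff ℝ ∞ c
  periodic : Function.Periodic c 1
  inj : ∀ s t, c s = c t → ∃ n : ℤ, s - t = n
  deriv_ne : ∀ t, deriv c t ≠ 0
  range_eq : Set.range c = frontier K

namespace IsOvalParam

variable {K : Set Plane} {c : ℝ → Plane} (hc : IsOvalParam K c)
include hc

theorem mem_frontier (t : ℝ) : c t ∈ frontier K := hc.range_eq ▸ Set.mem_range_self t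

theorem frontier_subset {x : Plane} (hx : x ∈ frontier K) : x ∈ K :=
  hc.isCompact.isClosed.frontier_subset hx

theorem mem (t : ℝ) : c t ∈ K := hc.frontier_subset (hc.mem_frontier t)

theorem hasDerivAt (t : ℝ) : HasDerivAt c (deriv c t) t :=
  (hc.contDiff.differentiable (by simp) t).hasDerivAt

theorem hasDerivAt_deriv (t : ℝ) : HasDerivAt (deriv c) (deriv (deriv c) t) t := by
  have h : ContDiff ℝ ∞ (deriv c) := (contDiff_infty_iff_deriv.1 hc.contDiff).2
  exact (h.differentiable (by simp) t).hasDerivAt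

theorem continuous_deriv : Continuous (deriv c) :=
  (contDiff_infty_iff_deriv.1 hc.contDiff).2.continuous

theorem exists_isTangentVec (t : ℝ) :
    ∃ σ : ℝ, (σ = 1 ∨ σ = -1) ∧ IsTangentVec K (c t) (σ • deriv c t) := by
  set v := deriv c t with hv
  obtain ⟨f, hf⟩ := geometric_hahn_banach_open_point hc.strictConvex.convex.interior
    isOpen_interior (hc.mem_frontier t).2
  have hlt : ∀ X ∈ K, X ≠ c t → f (X - c t) < 0 := by
    intro X hX hne
    have := hf _ (mem_interior_of_between hc.strictConvex (hc.mem t) hX hne.symm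
      (s := 1 / 2) (by norm_num) (by norm_num))
    rw [map_add, map_smul, smul_eq_mul] at this
    linarith
  have hmax : IsLocalMax (fun s => f (c s)) t := by
    refine Filter.Eventually.of_forall fun s => ?_
    by_cases hs : c s = c t
    · simp [hs]
    · have := hlt _ (hc.mem s) hs
      rw [map_sub] at this
      simp only
      linarith
  have hfv : f v = 0 := hmax.hasDerivAt_eq_zero (f.hasFDerivAt.comp_hasDerivAt t (hc.hasDerivAt t))
  -- The kernel of `f` is the line of `v`, so `f` is a multiple of `wedge v`; the vector `J`, normal
  -- to `v`, serves to compare them.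
  let J : Plane := !₂[-v 1, v 0]
  have hvJ : 0 < wedge v J := by
    have hne : v ≠ 0 := hc.deriv_ne t
    have : wedge v J = v 0 ^ 2 + v 1 ^ 2 := by simp [wedge, J]; ring
    rw [this]
    by_contra hle
    have h0 : v 0 = 0 := by nlinarith [sq_nonneg (v 0), sq_nonneg (v 1)]
    have h1 : v 1 = 0 := by nlinarith [sq_nonneg (v 0), sq_nonneg (v 1)]
    exact hne (plane_ext (by simpa using h0) (by simpa using h1))
  have key : ∀ w, f w * wedge v J = wedge v w * f J := by
    intro w
    obtain ⟨r, s, rfl⟩ := exists_combination hvJ.ne' w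
    rw [map_add, map_smul, map_smul, hfv, wedge_add_right, wedge_smul_right, wedge_smul_right,
      wedge_self_eq_zero, smul_eq_mul, smul_eq_mul]
    ring
  rcases lt_or_ge (f J) 0 with hJ | hJ
  · refine ⟨1, Or.inl rfl, fun X hX hne => ?_⟩
    have h1 := key (X - c t)
    have h2 := mul_neg_of_neg_of_pos (hlt X hX hne) hvJ
    rw [one_smul]
    by_contra h3
    have := mul_nonneg_of_nonpos_of_nonpos (not_lt.1 h3) hJ.le
    linarith
  · refine ⟨-1, Or.inr rfl, fun X hX hne => ?_⟩
    have h1 := key (X - c t)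
    have h2 := mul_neg_of_neg_of_pos (hlt X hX hne) hvJ
    rw [wedge_smul_left]
    by_contra h3
    have := mul_nonneg (by linarith : 0 ≤ wedge v (X - c t)) hJ
    linarith

end IsOvalParam

theorem eventually_mul_pos_of_hasDerivAt {g : ℝ → ℝ} {D t : ℝ} (hg : HasDerivAt g D t)
    (h0 : g t = 0) (hD : 0 < D) : ∀ᶠ s in nhdsWithin t {t}ᶜ, 0 < (s - t) * g s := by
  have h := (hasDerivAt_iff_tendsto_slope.1 hg).eventually (lt_mem_nhds hD)
  filter_upwards [h, self_mem_nhdsWithin] with s hs hne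
  have hst : s - t ≠ 0 := sub_ne_zero.2 hne
  rw [slope_def_field, h0, sub_zero] at hs
  have h2 := mul_pos hs (by positivity : 0 < (s - t) ^ 2)
  have : g s / (s - t) * (s - t) ^ 2 = (s - t) * g s := by field_simp
  rwa [this] at h2

theorem neBot_nhdsWithin_pos_of_hasDerivAt {g : ℝ → ℝ} {D t : ℝ} (hg : HasDerivAt g D t)
    (h0 : g t = 0) (hD : D ≠ 0) : (nhdsWithin t {s | 0 < g s}).NeBot := by
  rw [← mem_closure_iff_nhdsWithin_neBot, mem_closure_iff_frequently]
  rcases lt_or_gt_of_ne hD with hD | hD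
  · have h := eventually_mul_pos_of_hasDerivAt hg.neg (by simp [h0]) (neg_pos.2 hD)
    have hlt : ∀ᶠ s in nhdsWithin t (Set.Iio t), 0 < g s := by
      filter_upwards [h.filter_mono (nhdsWithin_mono t fun x (hx : x < t) => ne_of_lt hx),
        self_mem_nhdsWithin] with s hs hs'
      have : 0 < (t - s) * g s := by
        have e : (s - t) * (-g) s = (t - s) * g s := by rw [Pi.neg_apply]; ring
        rwa [e] at hs
      exact pos_of_mul_pos_right this (sub_nonneg.2 (le_of_lt hs'))
    exact hlt.frequently.filter_mono nhdsWithin_le_nhds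
  · have h := eventually_mul_pos_of_hasDerivAt hg h0 hD
    have hgt : ∀ᶠ s in nhdsWithin t (Set.Ioi t), 0 < g s := by
      filter_upwards [h.filter_mono (nhdsWithin_mono t fun x (hx : t < x) => ne_of_gt hx),
        self_mem_nhdsWithin] with s hs hs'
      exact pos_of_mul_pos_right hs (sub_nonneg.2 (le_of_lt hs'))
    exact hgt.frequently.filter_mono nhdsWithin_le_nhds

theorem exists_pos_of_hasDerivAt {g : ℝ → ℝ} {D t : ℝ} (hg : HasDerivAt g D t)
    (h0 : g t = 0) (hD : D ≠ 0) : ∃ s, 0 < g s := by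
  have := neBot_nhdsWithin_pos_of_hasDerivAt hg h0 hD
  have hmem : ∀ᶠ s in nhdsWithin t {s | 0 < g s}, 0 < g s := self_mem_nhdsWithin
  exact hmem.exists

/-- A fixed point of the involution of the pencil with centre `P` is a point of tangency: a line
transversal to the curve at `x` enters the interior and so meets the curve a second time. -/
theorem IsOvalParam.wedge_eq_zero_of_fixed {K : Set Plane} {c : ℝ → Plane} (hc : IsOvalParam K c)
    {P : Plane} (hP : P ∉ K) {t : ℝ} {x : frontier K} (hx : c t = x)
    (hfix : pencilMap (frontier K) P x = x) : wedge (deriv c t) (P - x) = 0 := by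
  by_contra hne
  have hw : P - (x : Plane) ≠ 0 := sub_ne_zero.2 (ne_frontier hc.isCompact hP x)
  have hder := hasDerivAt_wedge (hc.hasDerivAt t) (P - (x : Plane)) x
  have h0 : wedge (P - (x : Plane)) (c t - x) = 0 := by simp [hx, wedge]
  have hD : wedge (P - (x : Plane)) (deriv c t) ≠ 0 := by rwa [wedge_swap, neg_ne_zero]
  obtain ⟨s, hs⟩ := exists_pos_of_hasDerivAt hder h0 hD
  obtain ⟨r, hr⟩ := exists_pos_of_hasDerivAt hder.neg (by simp [h0]) (neg_ne_zero.2 hD)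
  replace hr : wedge (P - (x : Plane)) (c r - x) < 0 := neg_pos.1 hr
  set g : Plane → ℝ := fun y => wedge (P - (x : Plane)) (y - x) with hg
  have hrs : c r ≠ c s := by
    intro h; rw [h] at hr; linarith
  -- The curve has points on both sides of the line `Px`; the segment between two such points meets
  -- that line in an interior point of `K`.
  obtain ⟨θ, hθ0, hθ1, hθ⟩ : ∃ θ : ℝ, 0 < θ ∧ θ < 1 ∧
      wedge (P - (x : Plane)) (c r + θ • (c s - c r) - x) = 0 := by
    have hd : 0 < g (c s) - g (c r) := by simp only [hg]; linarith
    refine ⟨-g (c r) / (g (c s) - g (c r)), div_pos (by simp only [hg]; linarith) hd, ?_, ?_⟩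
    · rw [div_lt_one hd]; simp only [hg]; linarith
    · rw [add_sub_right_comm, wedge_add_right, wedge_smul_right,
        show c s - c r = (c s - x) - (c r - x) by abel, wedge_sub_right _ (c s - x)]
      change g (c r) + -g (c r) / (g (c s) - g (c r)) * (g (c s) - g (c r)) = 0
      field_simp; ring
  set z := c r + θ • (c s - c r)
  have hz : z ∈ interior K := mem_interior_of_between hc.strictConvex (hc.mem r) (hc.mem s) hrs
    hθ0 hθ1
  have hzx : z - x ≠ 0 := sub_ne_zero.2 fun h => x.2.2 (h ▸ hz)
  obtain ⟨u, hu, hy⟩ := exists_pos_mem_frontier hc.isCompact hz hzx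
  obtain ⟨ρ, hρ⟩ := exists_smul_of_wedge_eq_zero hw hθ
  have hyx : (⟨_, hy⟩ : frontier K) ≠ x := by
    intro h
    have h' : z + u • (z - x) - x = 0 := sub_eq_zero.2 (congrArg Subtype.val h)
    have h2 : (1 + u) • (z - (x : Plane)) = 0 := by rw [← h']; module
    rcases smul_eq_zero.1 h2 with h3 | h3
    · linarith
    · exact hzx h3
  refine hyx ((pencilMap_eq hc.isCompact hc.strictConvex hyx ?_).symm.trans hfix)
  rw [mem_line_iff_exists]
  refine ⟨1 - (1 + u) * ρ, ?_⟩
  have : z = x + ρ • (P - (x : Plane)) := by rw [← hρ]; abel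
  simp only [this]
  module

theorem pencilMap_fixed_of_isTangentVec {K : Set Plane} (hK : IsCompact K)
    {P T : Plane} {x : frontier K} (hT : IsTangentVec K x T)
    (h : wedge T (P - x) = 0) : pencilMap (frontier K) P x = x := by
  by_contra hne
  obtain ⟨r, hr⟩ := mem_line_iff_exists.1 (pencilMap_mem_line (P := P) x)
  have hpos := hT _ (hK.isClosed.frontier_subset (pencilMap (frontier K) P x).2)
    fun h => hne (Subtype.ext h)
  have : (pencilMap (frontier K) P x : Plane) - x = (1 - r) • (P - (x : Plane)) := by
    rw [hr]; module
  rw [this, wedge_smul_right, h, mul_zero] at hpos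
  exact lt_irrefl _ hpos

/-! ### Poles of chords -/

/-- The point `Q` is the pole of the chord `ab` of `K`: the tangents at `a` and `b`, directed by
`S` and `T`, meet in `Q`. -/
structure IsPole (K : Set Plane) (a b Q S T : Plane) : Prop where
  left_mem : a ∈ frontier K
  right_mem : b ∈ frontier K
  ne : a ≠ b
  left_tangent : IsTangentVec K a S
  right_tangent : IsTangentVec K b T
  left_wedge : wedge S (Q - a) = 0
  right_wedge : wedge T (Q - b) = 0

namespace IsPole

variable {K : Set Plane} {a b Q S T : Plane} (h : IsPole K a b Q S T) (hK : IsCompact K)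
include h

theorem symm : IsPole K b a Q T S :=
  ⟨h.right_mem, h.left_mem, h.ne.symm, h.right_tangent, h.left_tangent, h.right_wedge,
    h.left_wedge⟩

theorem notMem : Q ∉ K := by
  intro hQ
  have h1 : Q = a := by_contra fun hne => (h.left_tangent Q hQ hne).ne' h.left_wedge
  have h2 : Q = b := by_contra fun hne => (h.right_tangent Q hQ hne).ne' h.right_wedge
  exact h.ne (h1.symm.trans h2)

include hK

theorem left_pos : 0 < wedge S (b - a) :=
  h.left_tangent b (hK.isClosed.frontier_subset h.right_mem) h.ne.symm

/-- A point of the line `ab` outside `K` and the pole `Q` of `ab` have commuting involutions: the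
contact points `a` and `b` of the tangents from `Q` form an orbit of period two. -/
theorem pencilMap_comm (hs : StrictConvex ℝ K)
    (hrot : ∀ P Q : Plane, P ≠ Q → (line[ℝ, P, Q] : Set Plane) ∩ frontier K = ∅ →
      IsConjugateToRotation (pencilComp (frontier K) P Q))
    {P : Plane} (hP : P ∉ K) (hPab : wedge (b - a) (P - a) = 0) :
    P ≠ Q ∧ (line[ℝ, P, Q] : Set Plane) ∩ frontier K = ∅ ∧
    pencilMap (frontier K) P ⟨a, h.left_mem⟩ = ⟨b, h.right_mem⟩ ∧
    ∀ x : frontier K, pencilMap (frontier K) P (pencilMap (frontier K) Q x) =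
      pencilMap (frontier K) Q (pencilMap (frontier K) P x) := by
  have hfr := hK.isClosed.frontier_subset
  obtain ⟨ρ, hρ⟩ := exists_smul_of_wedge_eq_zero (sub_ne_zero.2 h.ne.symm) hPab
  have hPeq : P = a + ρ • (b - a) := by rw [← hρ]; abel
  have hβ : 0 < wedge S (b - a) := h.left_pos hK
  have hα : 0 < wedge T (a - b) := h.symm.left_pos hK
  have hρout : ρ * (1 - ρ) < 0 := by
    by_contra hle
    have h0 : 0 ≤ ρ ∧ ρ ≤ 1 := by constructor <;> nlinarith
    apply hP
    have := hs.convex (hfr h.left_mem) (hfr h.right_mem) (sub_nonneg.2 h0.2) h0.1 (by ring)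
    convert this using 1
    rw [hPeq]; module
  have hPβ : wedge S (P - a) = ρ * wedge S (b - a) := by rw [hρ, wedge_smul_right]
  have hPα : wedge T (P - b) = (1 - ρ) * wedge T (a - b) := by
    rw [← wedge_smul_right, hPeq]; congr 1; module
  have hPQ : P ≠ Q := by
    rintro rfl
    rw [h.left_wedge] at hPβ
    rcases mul_eq_zero.1 hPβ.symm with h0 | h0
    · simp [h0] at hρout
    · exact hβ.ne' h0
  have hline : (line[ℝ, P, Q] : Set Plane) ∩ frontier K = ∅ := by
    rw [Set.eq_empty_iff_forall_notMem]
    rintro X ⟨hX, hXK⟩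
    obtain ⟨r, hr⟩ := mem_line_iff_exists.1 hX
    have h1 := h.left_tangent.nonneg (hfr hXK)
    have h2 := h.right_tangent.nonneg (hfr hXK)
    have e1 : wedge S (X - a) = (1 - r) * (ρ * wedge S (b - a)) := by
      rw [← hPβ, show X - a = (1 - r) • (P - a) + r • (Q - a) by rw [hr]; module,
        wedge_add_right, wedge_smul_right, wedge_smul_right, h.left_wedge]; ring
    have e2 : wedge T (X - b) = (1 - r) * ((1 - ρ) * wedge T (a - b)) := by
      rw [← hPα, show X - b = (1 - r) • (P - b) + r • (Q - b) by rw [hr]; module,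
        wedge_add_right, wedge_smul_right, wedge_smul_right, h.right_wedge]; ring
    by_cases hr1 : r = 1
    · apply h.notMem
      have : X = Q := by rw [hr, hr1]; module
      exact this ▸ hfr hXK
    · have h3 := mul_nonneg h1 h2
      have h4 : 0 < (1 - r) ^ 2 := by have := sub_ne_zero.2 (Ne.symm hr1); positivity
      have h5 : 0 < (1 - r) ^ 2 * (wedge S (b - a) * wedge T (a - b)) := by positivity
      rw [e1, e2] at h3
      nlinarith
  have hPa : pencilMap (frontier K) P ⟨a, h.left_mem⟩ = ⟨b, h.right_mem⟩ := by
    refine pencilMap_eq_of_wedge hK hs hP (fun he => h.ne (congrArg Subtype.val he).symm) ?_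
    simp only [hPeq]
    rw [show a - (a + ρ • (b - a)) = (-ρ) • (b - a) by module,
      show b - (a + ρ • (b - a)) = (1 - ρ) • (b - a) by module, wedge_smul_left, wedge_smul_right,
      wedge_self_eq_zero, mul_zero, mul_zero]
  exact ⟨hPQ, hline, hPa, pencilMap_comm_of_orbit hK hs hP h.notMem (hrot P Q hPQ hline)
    (pencilMap_fixed_of_isTangentVec hK h.left_tangent h.left_wedge)
    (pencilMap_fixed_of_isTangentVec hK h.right_tangent h.right_wedge) hPa⟩

/-- The ratio of the heights over the line `ab`, measured in an affine chart that sends the pole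
`Q` of `ab` to infinity, is the same on all chords through `Q`. In that chart this says that the
two arcs are vertical dilates of each other. -/
theorem ratio_eq (hs : StrictConvex ℝ K)
    (hrot : ∀ P Q : Plane, P ≠ Q → (line[ℝ, P, Q] : Set Plane) ∩ frontier K = ∅ →
      IsConjugateToRotation (pencilComp (frontier K) P Q))
    {x y : frontier K} (hxy : 0 < wedge (b - a) (x - a) * wedge (b - a) (y - a))
    (hne : wedge (b - a) (x - a) ≠ wedge (b - a) (y - a)) {x' y' : frontier K}
    (hx' : pencilMap (frontier K) Q x = x') (hy' : pencilMap (frontier K) Q y = y') :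
    wedge (b - a) (x - a) * wedge T (x' - b) * (wedge (b - a) (y' - a) * wedge T (y - b)) =
      wedge (b - a) (x' - a) * wedge T (x - b) * (wedge (b - a) (y - a) * wedge T (y' - b)) := by
  have hfr := hK.isClosed.frontier_subset
  set κ : Plane → ℝ := fun X => wedge (b - a) (X - a) with hκ
  have hd : κ x - κ y ≠ 0 := sub_ne_zero.2 hne
  -- `p` is the intersection of the lines `xy` and `ab`. It is not in `K`, because `x` and `y` lie
  -- on the same side of `ab`.
  set θ := κ x / (κ x - κ y) with hθ
  set p : Plane := x + θ • ((y : Plane) - x) with hp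
  have hxyne : (x : Plane) ≠ y := fun he => hne (by rw [he])
  have hκaff : ∀ (X Y : Plane) (r : ℝ), κ (X + r • (Y - X)) = κ X + r * (κ Y - κ X) := by
    intro X Y r
    simp only [hκ]
    rw [← wedge_sub_right, ← wedge_smul_right, ← wedge_add_right]
    congr 1; module
  have hκp : κ p = 0 := by
    rw [hp, hκaff, hθ]; field_simp; ring
  have hθout : θ < 0 ∨ 1 < θ := by
    have h1 : θ * (κ x - κ y) = κ x := by rw [hθ]; field_simp
    have h2 : (θ - 1) * (κ x - κ y) = κ y := by linarith
    have h3 : 0 < θ * (θ - 1) := by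
      have h4 : κ x * κ y = θ * (θ - 1) * (κ x - κ y) ^ 2 := by
        calc κ x * κ y = θ * (κ x - κ y) * ((θ - 1) * (κ x - κ y)) := by rw [h1, h2]
          _ = _ := by ring
      have h5 : 0 < θ * (θ - 1) * (κ x - κ y) ^ 2 := h4 ▸ hxy
      exact pos_of_mul_pos_left h5 (sq_nonneg _)
    by_contra! h6
    nlinarith
  have hpK : p ∉ K := by
    intro hpK
    have hv : (y : Plane) - x ≠ 0 := sub_ne_zero.2 hxyne.symm
    have e0 : (x : Plane) + (0 : ℝ) • ((y : Plane) - x) = x := by module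
    have e1 : (x : Plane) + (1 : ℝ) • ((y : Plane) - x) = y := by module
    rcases hθout with ht | ht
    · exact false_of_three_params hs hv ht one_pos hpK (e1.symm ▸ hfr y.2) (e0.symm ▸ x.2)
    · exact false_of_three_params hs hv one_pos ht (e0.symm ▸ hfr x.2) hpK (e1.symm ▸ y.2)
  obtain ⟨hpQ, hline, -, hcomm⟩ := h.pencilMap_comm hK hs hrot hpK hκp
  have hpx : pencilMap (frontier K) p x = y := by
    refine pencilMap_eq_of_wedge hK hs hpK (fun he => hxyne (congrArg Subtype.val he).symm) ?_
    rw [show (x : Plane) - p = (-θ) • ((y : Plane) - x) by rw [hp]; module,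
      show (y : Plane) - p = (1 - θ) • ((y : Plane) - x) by rw [hp]; module,
      wedge_smul_left, wedge_smul_right, wedge_self_eq_zero, mul_zero, mul_zero]
  have hpx' : pencilMap (frontier K) p x' = y' := by rw [← hx', hcomm, hpx, hy']
  obtain ⟨r, hr⟩ := mem_line_iff_exists.1 (hpx ▸ pencilMap_mem_line (P := p) x)
  obtain ⟨r', hr'⟩ := mem_line_iff_exists.1 (hpx' ▸ pencilMap_mem_line (P := p) x')
  obtain ⟨l, hl⟩ := mem_line_iff_exists.1 (hx' ▸ pencilMap_mem_line (P := Q) x)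
  obtain ⟨m, hm⟩ := mem_line_iff_exists.1 (hy' ▸ pencilMap_mem_line (P := Q) y)
  have hind : wedge (p - Q) ((x : Plane) - Q) ≠ 0 := by
    intro h0
    rw [Set.eq_empty_iff_forall_notMem] at hline
    refine hline x ⟨?_, x.2⟩
    rw [SetLike.mem_coe, Set.pair_comm]
    exact (mem_line_iff hpQ.symm).2 h0
  -- Compare the coefficients of `x - Q` in the two expressions of `y' - Q` along the quadrangle.
  have hcoef : m * r = r' * l := by
    have e : m • ((y : Plane) - Q) = (y' : Plane) - Q := by rw [hm]; module
    rw [hr', hl, hr] at e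
    have e2 := congrArg (wedge (p - Q)) e
    rw [show m • (p + r • ((x : Plane) - p) - Q) =
        (m * (1 - r)) • (p - Q) + (m * r) • ((x : Plane) - Q) by module,
      show p + r' • (Q + l • ((x : Plane) - Q) - p) - Q =
        (1 - r') • (p - Q) + (r' * l) • ((x : Plane) - Q) by module,
      wedge_add_right, wedge_add_right, wedge_smul_right, wedge_smul_right, wedge_smul_right,
      wedge_smul_right, wedge_self_eq_zero, mul_zero, mul_zero, zero_add, zero_add] at e2
    exact mul_right_cancel₀ hind e2
  have k1 : κ y = r * κ x := by rw [hr, hκaff, hκp]; ring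
  have k2 : κ y' = r' * κ x' := by rw [hr', hκaff, hκp]; ring
  have hα : ∀ (X Y : Plane) (r : ℝ), Y = Q + r • (X - Q) →
      wedge T (Y - b) = r * wedge T (X - b) := by
    rintro X Y r rfl
    rw [show Q + r • (X - Q) - b = (1 - r) • (Q - b) + r • (X - b) by module, wedge_add_right,
      wedge_smul_right, wedge_smul_right, h.right_wedge]
    ring
  change κ x * wedge T (x' - b) * (κ y' * wedge T (y - b)) =
    κ x' * wedge T (x - b) * (κ y * wedge T (y' - b))
  rw [k1, k2, hα _ _ _ hl, hα _ _ _ hm]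
  linear_combination (-κ x * wedge T (x - b) * κ x' * wedge T (y - b)) * hcoef

end IsPole

/-! ### The harmonic property at points of nonzero curvature -/

theorem tendsto_div_sq_of_hasDerivAt {g g' : ℝ → ℝ} {D t : ℝ} (hg : ∀ s, HasDerivAt g (g' s) s)
    (hg' : HasDerivAt g' D t) (h0 : g t = 0) (h1 : g' t = 0) :
    Filter.Tendsto (fun s => g s / (s - t) ^ 2) (nhdsWithin t {t}ᶜ) (nhds (D / 2)) := by
  have hq : ∀ s, HasDerivAt (fun s => (s - t) ^ 2) (2 * (s - t)) s := fun s => by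
    simpa using ((hasDerivAt_id' s).sub_const t).fun_pow 2
  refine HasDerivAt.lhopital_zero_nhdsNE (f' := g') (g' := fun s => 2 * (s - t))
    (Filter.Eventually.of_forall hg) (Filter.Eventually.of_forall hq) ?_ ?_ ?_ ?_
  · filter_upwards [self_mem_nhdsWithin] with s hs
    exact mul_ne_zero two_ne_zero (sub_ne_zero.2 hs)
  · have := (hg t).continuousAt.tendsto
    rw [h0] at this
    exact this.mono_left nhdsWithin_le_nhds
  · have := (hq t).continuousAt.tendsto
    simp only [sub_self, ne_eq, OfNat.ofNat_ne_zero, not_false_eq_true, zero_pow] at this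
    exact this.mono_left nhdsWithin_le_nhds
  · have := (hasDerivAt_iff_tendsto_slope.1 hg').div_const 2
    refine this.congr fun s => ?_
    rw [slope_def_field, h1, sub_zero, div_div, mul_comm (2 : ℝ)]

namespace IsPole

variable {K : Set Plane} {a b Q S T : Plane} (h : IsPole K a b Q S T)
include h

theorem wedge_pole_ne (hK : IsCompact K) : wedge (b - a) (Q - a) ≠ 0 := by
  intro h0
  obtain ⟨r, hr⟩ := exists_smul_of_wedge_eq_zero (sub_ne_zero.2 h.ne.symm) h0
  have h1 := h.left_wedge
  rw [hr, wedge_smul_right] at h1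
  have hr0 := (mul_eq_zero.1 h1).resolve_right (h.left_pos hK).ne'
  rw [hr0, zero_smul, sub_eq_zero] at hr
  exact h.notMem (hr ▸ hK.isClosed.frontier_subset h.left_mem)

/-- The quotient `κ² / (αβ)` of the equations of the chord `ab` and of the tangents at its end
points has a nonzero limit at `a` along the curve, if the curvature at `a` does not vanish. -/
theorem tendsto_quotient {c : ℝ → Plane} (hc : IsOvalParam K c) {t σ : ℝ} (hat : c t = a)
    (hσ : σ ≠ 0) (hS : S = σ • deriv c t) (hflat : wedge (deriv c t) (deriv (deriv c) t) ≠ 0) :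
    ∃ L : ℝ, L ≠ 0 ∧ Filter.Tendsto (fun s => wedge (b - a) (c s - a) ^ 2 /
      (wedge T (c s - b) * wedge S (c s - a))) (nhdsWithin t {t}ᶜ) (nhds L) := by
  have hα : 0 < wedge T (a - b) := h.symm.left_pos hc.isCompact
  have hD : wedge (b - a) (deriv c t) ≠ 0 := by
    have := (h.left_pos hc.isCompact).ne'
    rw [hS, wedge_smul_left] at this
    rw [wedge_swap, neg_ne_zero]
    exact right_ne_zero_of_mul this
  have hκ : Filter.Tendsto (fun s => wedge (b - a) (c s - a) / (s - t)) (nhdsWithin t {t}ᶜ)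
      (nhds (wedge (b - a) (deriv c t))) := by
    refine (hasDerivAt_iff_tendsto_slope.1 (hasDerivAt_wedge (hc.hasDerivAt t) (b - a) a)).congr
      fun s => ?_
    rw [slope_def_field, hat]
    simp [wedge]
  have hβ := tendsto_div_sq_of_hasDerivAt (t := t)
    (fun s => hasDerivAt_wedge (hc.hasDerivAt s) S a)
    (by simpa using hasDerivAt_wedge (hc.hasDerivAt_deriv t) S 0) (by simp [hat, wedge])
    (by rw [hS, wedge_smul_left, wedge_self_eq_zero, mul_zero])
  have hαt : Filter.Tendsto (fun s => wedge T (c s - b)) (nhdsWithin t {t}ᶜ)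
      (nhds (wedge T (a - b))) := by
    have : Continuous fun s => wedge T (c s - b) :=
      (continuous_wedge T b).comp hc.contDiff.continuous
    rw [← hat]
    exact this.continuousAt.tendsto.mono_left nhdsWithin_le_nhds
  have hβ0 : wedge S (deriv (deriv c) t) / 2 ≠ 0 := by
    rw [hS, wedge_smul_left]
    exact div_ne_zero (mul_ne_zero hσ hflat) two_ne_zero
  refine ⟨_, div_ne_zero (pow_ne_zero 2 hD) (mul_ne_zero hα.ne' hβ0),
    ((hκ.pow 2).div (hαt.mul hβ) (mul_ne_zero hα.ne' hβ0)).congr' ?_⟩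
  filter_upwards [self_mem_nhdsWithin] with s hs
  have : s - t ≠ 0 := sub_ne_zero.2 hs
  simp only [Pi.div_apply]
  field_simp

/-- If the curvature at `a` does not vanish, then the chords through the pole `Q` of `ab` are
divided harmonically by `Q` and the line `ab`. -/
theorem harmonic {c : ℝ → Plane} (hc : IsOvalParam K c) {t σ : ℝ} (hat : c t = a)
    (hσ : σ ≠ 0) (hS : S = σ • deriv c t) (hflat : wedge (deriv c t) (deriv (deriv c) t) ≠ 0)
    (hrot : ∀ P Q : Plane, P ≠ Q → (line[ℝ, P, Q] : Set Plane) ∩ frontier K = ∅ →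
      IsConjugateToRotation (pencilComp (frontier K) P Q))
    {x x' : frontier K} (hx0 : wedge (b - a) ((x : Plane) - a) ≠ 0)
    (hx' : pencilMap (frontier K) Q x = x') (hne : x' ≠ x) :
    wedge (b - a) ((x : Plane) - a) * wedge T ((x' : Plane) - b) +
      wedge (b - a) ((x' : Plane) - a) * wedge T ((x : Plane) - b) = 0 := by
  have hK := hc.isCompact
  have hs := hc.strictConvex
  have hfr := hK.isClosed.frontier_subset
  have hinv := pencilMap_involutive hK hs h.notMem
  set κ : Plane → ℝ := fun X => wedge (b - a) (X - a) with hκ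
  set α : Plane → ℝ := fun X => wedge T (X - b) with hα
  set β : Plane → ℝ := fun X => wedge S (X - a) with hβ
  have hQa : pencilMap (frontier K) Q ⟨a, h.left_mem⟩ = ⟨a, h.left_mem⟩ :=
    pencilMap_fixed_of_isTangentVec hK h.left_tangent h.left_wedge
  have hQb : pencilMap (frontier K) Q ⟨b, h.right_mem⟩ = ⟨b, h.right_mem⟩ :=
    pencilMap_fixed_of_isTangentVec hK h.right_tangent h.right_wedge
  have hκa : κ a = 0 := by simp [hκ, wedge]
  have hκb : κ b = 0 := wedge_self_eq_zero _
  have hαpos : ∀ X : frontier K, κ X ≠ 0 → 0 < α X := fun X hX =>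
    h.right_tangent X (hfr X.2) fun he => hX (he ▸ hκb)
  have hβpos : ∀ X : frontier K, κ X ≠ 0 → 0 < β X := fun X hX =>
    h.left_tangent X (hfr X.2) fun he => hX (he ▸ hκa)
  have hκmap : ∀ X : frontier K, κ X ≠ 0 → κ (pencilMap (frontier K) Q X) ≠ 0 := by
    intro X hX h0
    rcases eq_or_eq_of_wedge_eq_zero hK hs h.left_mem h.right_mem
        (pencilMap (frontier K) Q X).2 h.ne h0 with h1 | h1
    · have h2 : pencilMap (frontier K) Q X = ⟨a, h.left_mem⟩ := Subtype.ext h1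
      have h3 : X = ⟨a, h.left_mem⟩ := by rw [← hinv X, h2, hQa]
      exact hX (by rw [h3]; exact hκa)
    · have h2 : pencilMap (frontier K) Q X = ⟨b, h.right_mem⟩ := Subtype.ext h1
      have h3 : X = ⟨b, h.right_mem⟩ := by rw [← hinv X, h2, hQb]
      exact hX (by rw [h3]; exact hκb)
  have hscale : ∀ X : frontier K, ∃ l : ℝ, (pencilMap (frontier K) Q X : Plane) =
      Q + l • ((X : Plane) - Q) ∧ α (pencilMap (frontier K) Q X) = l * α X ∧
      β (pencilMap (frontier K) Q X) = l * β X := by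
    intro X
    obtain ⟨l, hl⟩ := mem_line_iff_exists.1 (pencilMap_mem_line (P := Q) X)
    refine ⟨l, hl, ?_, ?_⟩
    · simp only [hα]
      rw [hl, show Q + l • ((X : Plane) - Q) - b = (1 - l) • (Q - b) + l • ((X : Plane) - b) by
        module, wedge_add_right, wedge_smul_right, wedge_smul_right, h.right_wedge]
      ring
    · simp only [hβ]
      rw [hl, show Q + l • ((X : Plane) - Q) - a = (1 - l) • (Q - a) + l • ((X : Plane) - a) by
        module, wedge_add_right, wedge_smul_right, wedge_smul_right, h.left_wedge]
      ring
  have hx'0 : κ x' ≠ 0 := hx' ▸ hκmap x hx0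
  -- `k` is the (signed) ratio of dilation between the two arcs; the claim is that `k = -1`.
  set k : ℝ := κ x' * α x / (κ x * α x') with hk
  obtain ⟨L, hL0, hL⟩ := h.tendsto_quotient hc hat hσ hS hflat
  set G : Plane → ℝ := fun X => κ X ^ 2 / (α X * β X) with hG
  -- Parameters near `t` for which `c s` lies on the same side of the line `ab` as `x`.
  set F : Filter ℝ := nhdsWithin t {s | 0 < κ x * κ (c s)} with hF
  have hD : κ x * wedge (b - a) (deriv c t) ≠ 0 := by
    have := (h.left_pos hK).ne'
    rw [hS, wedge_smul_left] at this
    refine mul_ne_zero hx0 ?_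
    rw [wedge_swap, neg_ne_zero]
    exact right_ne_zero_of_mul this
  have hcκ : κ (c t) = 0 := by rw [hat]; exact hκa
  have : F.NeBot := neBot_nhdsWithin_pos_of_hasDerivAt
    ((hasDerivAt_wedge (hc.hasDerivAt t) (b - a) a).const_mul (κ x)) (by
      rw [hcκ, mul_zero]) hD
  have hFne : F ≤ nhdsWithin t {t}ᶜ := nhdsWithin_mono t fun s (hs : 0 < κ x * κ (c s)) he => by
    rw [Set.mem_singleton_iff.1 he, hcκ, mul_zero] at hs
    exact lt_irrefl _ hs
  have hcont : ∀ u v : Plane, Continuous fun s => wedge u (c s - v) := fun u v =>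
    (continuous_wedge u v).comp hc.contDiff.continuous
  have hFpos : ∀ᶠ s in F, 0 < κ x * κ (c s) := self_mem_nhdsWithin
  have hFκ : ∀ᶠ s in F, κ x ≠ κ (c s) := by
    have : Filter.Tendsto (fun s => κ (c s)) F (nhds 0) := by
      have := (hcont (b - a) a).continuousAt (x := t) |>.tendsto.mono_left
        (nhdsWithin_le_nhds (s := {s | 0 < κ x * κ (c s)}))
      rwa [show wedge (b - a) (c t - a) = 0 from hcκ] at this
    filter_upwards [this.eventually_ne hx0.symm] with s hs
    exact hs.symm
  set y : ℝ → frontier K := fun s => ⟨c s, hc.mem_frontier s⟩ with hy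
  have hrel : ∀ᶠ s in F, κ (c s) ≠ 0 ∧
      κ (pencilMap (frontier K) Q (y s)) * α (c s) =
        k * κ (c s) * α (pencilMap (frontier K) Q (y s)) := by
    filter_upwards [hFpos, hFκ] with s h1 h2
    refine ⟨right_ne_zero_of_mul h1.ne', ?_⟩
    have h3 := h.ratio_eq hK hs hrot (x := x) (y := y s) h1 h2 hx' rfl
    have hne : κ x * α x' ≠ 0 := mul_ne_zero hx0 (hαpos x' hx'0).ne'
    change κ x * α x' * (κ (pencilMap (frontier K) Q (y s)) * α (c s)) =
      κ x' * α x * (κ (c s) * α (pencilMap (frontier K) Q (y s))) at h3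
    apply mul_left_cancel₀ hne
    have h4 : κ x * α x' * k = κ x' * α x := mul_div_cancel₀ _ hne
    linear_combination h3 - κ (c s) * α (pencilMap (frontier K) Q (y s)) * h4
  have hGrel : ∀ᶠ s in F, G (pencilMap (frontier K) Q (y s)) = k ^ 2 * G (c s) := by
    filter_upwards [hrel] with s ⟨h1, h2⟩
    have h3 := hκmap (y s) h1
    obtain ⟨l, -, hl1, hl2⟩ := hscale (y s)
    have p1 := hαpos (y s) h1
    have p2 := hβpos (y s) h1
    have p3 := hαpos _ h3
    simp only [hy] at p1 p2 hl1 hl2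
    have hl0 : l ≠ 0 := by rintro rfl; rw [hl1] at p3; simp at p3
    have h4 : κ (pencilMap (frontier K) Q (y s)) = k * l * κ (c s) := by
      apply mul_right_cancel₀ p1.ne'
      rw [h2, hl1]; ring
    simp only [hG]
    rw [h4, hl1, hl2]
    field_simp
  -- A parameter of `f_Q (c s)` in a fundamental interval around `t`.
  have hτ : ∀ X : frontier K, ∃ r ∈ Set.Icc (t - 1 / 2) (t + 1 / 2), c r = X := by
    intro X
    obtain ⟨u, hu⟩ : (X : Plane) ∈ Set.range c := by rw [hc.range_eq]; exact X.2
    obtain ⟨r, hr, hr'⟩ := hc.periodic.exists_mem_Ico one_pos u (t - 1 / 2)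
    exact ⟨r, ⟨hr.1, by linarith [hr.2]⟩, by rw [← hr', hu]⟩
  choose τ hτI hτc using hτ
  set w : ℝ → ℝ := fun s => τ (pencilMap (frontier K) Q (y s)) with hw
  have hwc : ∀ s, c (w s) = pencilMap (frontier K) Q (y s) := fun s => hτc _
  obtain ⟨M, hM⟩ := (isCompact_Icc (a := t - 1 / 2) (b := t + 1 / 2)).exists_bound_of_continuousOn
    (hcont T b).continuousOn
  have hβw : Filter.Tendsto (fun s => β (c (w s))) F (nhds 0) := by
    have h1 : Filter.Tendsto (fun s => β (c s) / α (c s)) F (nhds 0) := by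
      have e1 := ((hcont S a).continuousAt (x := t)).tendsto
      have e2 := ((hcont T b).continuousAt (x := t)).tendsto
      have e3 := (e1.div e2 (by rw [hat]; exact (h.symm.left_pos hK).ne')).mono_left
        (nhdsWithin_le_nhds (s := {s | 0 < κ x * κ (c s)}))
      rwa [hat, sub_self, show wedge S 0 = 0 by simp [wedge], zero_div] at e3
    refine squeeze_zero_norm' (a := fun s => |β (c s) / α (c s)| * M) ?_
      (by simpa using h1.abs.mul_const M)
    filter_upwards [hrel] with s ⟨h1, h2⟩
    obtain ⟨l, -, hl1, hl2⟩ := hscale (y s)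
    have p1 := hαpos (y s) h1
    simp only [hy] at p1 hl1 hl2
    have e : β (c (w s)) = β (c s) / α (c s) * α (c (w s)) := by
      rw [hwc, hl1, hl2]; field_simp
    rw [e, norm_mul, Real.norm_eq_abs]
    exact mul_le_mul_of_nonneg_left (hM _ (hτI _)) (abs_nonneg _)
  have hwt : Filter.Tendsto w F (nhds t) := by
    refine isCompact_Icc.tendsto_nhds_of_unique_mapClusterPt
      (Filter.Eventually.of_forall fun s => hτI _) fun r hr hcl => ?_
    have h1 : MapClusterPt (β (c r)) F (fun s => β (c (w s))) :=
      hcl.continuousAt_comp (f := fun s => β (c s)) (hcont S a).continuousAt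
    have h2 : β (c r) = 0 := by
      exact eq_of_nhds_neBot ((h1.clusterPt.neBot).mono (inf_le_inf_left _ hβw))
    have h3 : c r = a := by
      by_contra hne
      exact (h.left_tangent _ (hc.mem r) hne).ne' h2
    obtain ⟨n, hn⟩ := hc.inj r t (h3.trans hat.symm)
    have hn0 : n = 0 := by
      have h4 : (-1 : ℝ) < n := by linarith [hr.1]
      have h5 : (n : ℝ) < 1 := by linarith [hr.2]
      have h4' : (-1 : ℤ) < n := by exact_mod_cast h4
      have h5' : n < (1 : ℤ) := by exact_mod_cast h5
      omega
    rw [hn0, Int.cast_zero, sub_eq_zero] at hn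
    exact hn
  have hwt' : Filter.Tendsto w F (nhdsWithin t {t}ᶜ) := by
    refine tendsto_nhdsWithin_iff.2 ⟨hwt, ?_⟩
    filter_upwards [hrel] with s ⟨h1, h2⟩ he
    have h3 := hκmap (y s) h1
    rw [← hwc, Set.mem_singleton_iff.1 he] at h3
    exact h3 hcκ
  have hk2 : k ^ 2 = 1 := by
    have h1 : Filter.Tendsto (fun s => G (c (w s))) F (nhds L) := hL.comp hwt'
    have h2 : Filter.Tendsto (fun s => k ^ 2 * G (c s)) F (nhds (k ^ 2 * L)) :=
      (hL.mono_left hFne).const_mul _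
    have h3 : k ^ 2 * L = L := tendsto_nhds_unique
      (h2.congr' (by filter_upwards [hGrel] with s hs; rw [hwc, hs])) h1
    exact mul_right_cancel₀ hL0 (h3.trans (one_mul L).symm)
  have hne2 : κ x * α x' ≠ 0 := mul_ne_zero hx0 (hαpos x' hx'0).ne'
  rcases sq_eq_one_iff.1 hk2 with h1 | h1
  · exfalso
    -- If `k = 1`, then `x` and `x'` have the same projective coordinates `α : β : κ`.
    rw [hk, div_eq_one_iff_eq hne2] at h1
    obtain ⟨l, hl, hl1, -⟩ := hscale x
    rw [hx'] at hl hl1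
    have e : κ x' = (1 - l) * κ Q + l * κ x := by
      simp only [hκ]
      rw [hl, ← wedge_smul_right, ← wedge_smul_right, ← wedge_add_right]
      congr 1; module
    have h2 : κ x' = l * κ x := by
      apply mul_right_cancel₀ (hαpos x hx0).ne'
      rw [h1, hl1]; ring
    have h3 : (1 - l) * κ Q = 0 := by linarith
    have h4 : l = 1 := by
      have := (mul_eq_zero.1 h3).resolve_right (h.wedge_pole_ne hK)
      linarith
    exact hne (Subtype.ext (by rw [hl, h4]; module))
  · rw [hk, div_eq_iff hne2] at h1
    change κ x * α x' + κ x' * α x = 0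
    rw [h1]; ring

end IsPole

/-! ### The curve lies on a conic -/

namespace IsOvalParam

variable {K : Set Plane} {c : ℝ → Plane} (hc : IsOvalParam K c)
include hc

theorem eq_of_near {s t : ℝ} (hst : c s = c t) (h : |s - t| < 1) : s = t := by
  obtain ⟨n, hn⟩ := hc.inj s t hst
  rw [hn] at h
  have h' : |n| < 1 := by exact_mod_cast h
  rw [Int.abs_lt_one_iff.1 h', Int.cast_zero, sub_eq_zero] at hn
  exact hn

/-- The curve contains no segment. -/
theorem exists_wedge_deriv_ne {v : Plane} (hv : v ≠ 0) {p q : ℝ} (hpq : p < q) :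
    ∃ s ∈ Set.Ioo p q, wedge v (deriv c s) ≠ 0 := by
  by_contra! h
  have hconst : ∀ s ∈ Set.Ioo p q, ∀ u ∈ Set.Ioo p q, wedge v (c s - 0) = wedge v (c u - 0) := by
    intro s hs u hu
    refine isOpen_Ioo.is_const_of_deriv_eq_zero isPreconnected_Ioo
      (fun z _ => (hasDerivAt_wedge (hc.hasDerivAt z) v 0).differentiableAt.differentiableWithinAt)
      (fun z hz => ?_) hs hu
    rw [(hasDerivAt_wedge (hc.hasDerivAt z) v 0).deriv, h z hz, Pi.zero_apply]
  set δ := min (q - p) 1 with hδ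
  have hδ0 : 0 < δ := lt_min (sub_pos.2 hpq) one_pos
  have hδ1 : δ ≤ q - p := min_le_left _ _
  have hδ2 : δ ≤ 1 := min_le_right _ _
  have mem : ∀ i : ℝ, 0 < i → i < 1 → p + i * δ ∈ Set.Ioo p q := fun i h0 h1 =>
    ⟨by nlinarith, by nlinarith⟩
  have ne : ∀ i j : ℝ, 0 < i → i < j → j < 1 → c (p + i * δ) ≠ c (p + j * δ) := by
    intro i j h0 hij h1 he
    have := hc.eq_of_near he (by
      rw [show p + i * δ - (p + j * δ) = -((j - i) * δ) by ring, abs_neg, abs_of_pos (by nlinarith)]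
      nlinarith)
    nlinarith
  have col : ∀ i j : ℝ, 0 < i → i < 1 → 0 < j → j < 1 →
      ∃ r : ℝ, c (p + j * δ) - c (p + i * δ) = r • v := by
    intro i j hi0 hi1 hj0 hj1
    refine exists_smul_of_wedge_eq_zero hv ?_
    have := hconst _ (mem j hj0 hj1) _ (mem i hi0 hi1)
    rw [wedge_sub_right, wedge_sub_right v (c (p + i * δ))] at this
    rw [wedge_sub_right]; linarith
  obtain ⟨r1, h1⟩ := col (1 / 4) (1 / 2) (by norm_num) (by norm_num) (by norm_num) (by norm_num)
  obtain ⟨r2, h2⟩ := col (1 / 4) (3 / 4) (by norm_num) (by norm_num) (by norm_num) (by norm_num)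
  rcases eq_or_eq_of_wedge_eq_zero hc.isCompact hc.strictConvex (hc.mem_frontier (p + 1 / 4 * δ))
    (hc.mem_frontier (p + 1 / 2 * δ)) (hc.mem_frontier (p + 3 / 4 * δ))
    (ne _ _ (by norm_num) (by norm_num) (by norm_num))
    (by rw [h1, h2, wedge_smul_left, wedge_smul_right, wedge_self_eq_zero, mul_zero, mul_zero])
    with h3 | h3
  · exact ne _ _ (by norm_num) (by norm_num) (by norm_num) h3.symm
  · exact ne _ _ (by norm_num) (by norm_num) (by norm_num) h3.symm

/-- Points of nonzero curvature are dense: the direction of `c'` is constant on an interval without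
such points. -/
theorem exists_wedge_deriv_deriv_ne {p q : ℝ} (hpq : p < q) :
    ∃ s ∈ Set.Ioo p q, wedge (deriv c s) (deriv (deriv c) s) ≠ 0 := by
  by_contra! h
  obtain ⟨m, hm⟩ := Set.nonempty_Ioo.2 hpq
  set n := deriv c m with hn
  obtain ⟨J, hJ⟩ : ∃ J : Plane, wedge J n ≠ 0 := by
    obtain ⟨s, -, hs⟩ := hc.exists_wedge_deriv_ne (hc.deriv_ne m) hpq
    exact ⟨deriv c s, by rwa [wedge_swap, neg_ne_zero]⟩
  have hcont : ∀ v : Plane, Continuous fun s => wedge v (deriv c s - 0) := fun v =>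
    (continuous_wedge v 0).comp hc.continuous_deriv
  simp only [sub_zero] at hcont
  have hU : IsOpen (Set.Ioo p q ∩ {s | wedge J (deriv c s) ≠ 0}) :=
    isOpen_Ioo.inter (isOpen_ne_fun (hcont J) continuous_const)
  obtain ⟨l, u, hmlu, hsub⟩ := mem_nhds_iff_exists_Ioo_subset.1 (hU.mem_nhds ⟨hm, hJ⟩)
  obtain ⟨s, hs, hne⟩ := hc.exists_wedge_deriv_ne (hc.deriv_ne m) (hmlu.1.trans hmlu.2)
  -- The slope of `c'` has zero derivative.
  have hd : ∀ z ∈ Set.Ioo l u,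
      HasDerivAt (fun s => wedge n (deriv c s - 0) / wedge J (deriv c s - 0)) 0 z := by
    intro z hz
    have h1 := hasDerivAt_wedge (hc.hasDerivAt_deriv z) n 0
    have h2 := hasDerivAt_wedge (hc.hasDerivAt_deriv z) J 0
    refine (h1.fun_div h2 (by rw [sub_zero]; exact (hsub hz).2)).congr_deriv ?_
    rw [div_eq_zero_iff]
    left
    have h4 := h z (hsub hz).1
    rw [sub_zero]
    simp only [wedge] at h4 ⊢
    linear_combination (n 1 * J 0 - n 0 * J 1) * h4
  have hconst := isOpen_Ioo.is_const_of_deriv_eq_zero isPreconnected_Ioo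
    (fun z hz => (hd z hz).differentiableAt.differentiableWithinAt)
    (fun z hz => (hd z hz).deriv) hs hmlu
  simp only [sub_zero] at hconst
  rw [wedge_self_eq_zero, zero_div, div_eq_zero_iff] at hconst
  rcases hconst with h0 | h0
  · exact hne h0
  · exact (hsub hs).2 h0

/-- Points of nonzero curvature whose tangent does not have a given direction are dense. -/
theorem exists_nonflat {v : Plane} (hv : v ≠ 0) {U : Set ℝ} (hU : IsOpen U) (hne : U.Nonempty) :
    ∃ s ∈ U, wedge (deriv c s) (deriv (deriv c) s) ≠ 0 ∧ wedge v (deriv c s) ≠ 0 := by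
  obtain ⟨m, hm⟩ := hne
  obtain ⟨p, q, hpq, hsub⟩ := mem_nhds_iff_exists_Ioo_subset.1 (hU.mem_nhds hm)
  obtain ⟨s, hs, hsv⟩ := hc.exists_wedge_deriv_ne hv (hpq.1.trans hpq.2)
  have hcont : Continuous fun s => wedge v (deriv c s - 0) :=
    (continuous_wedge v 0).comp hc.continuous_deriv
  simp only [sub_zero] at hcont
  obtain ⟨l, u, hlu, hsub'⟩ := mem_nhds_iff_exists_Ioo_subset.1
    ((isOpen_Ioo.inter (isOpen_ne_fun hcont continuous_const)).mem_nhds ⟨hs, hsv⟩)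
  obtain ⟨z, hz, hzf⟩ := hc.exists_wedge_deriv_deriv_ne (hlu.1.trans hlu.2)
  exact ⟨z, hsub (hsub' hz).1, hzf, (hsub' hz).2⟩

end IsOvalParam

namespace IsPole

variable {K : Set Plane} {a b Q S T : Plane} (h : IsPole K a b Q S T) {c : ℝ → Plane}
  (hc : IsOvalParam K c)
include h hc

/-- The vectors from the pole to the contact points form a basis. -/
theorem wedge_coord_ne : wedge (a - Q) (b - Q) ≠ 0 := by
  have := h.wedge_pole_ne hc.isCompact
  rwa [show b - a = (b - Q) - (a - Q) by abel, show Q - a = (-1 : ℝ) • (a - Q) by module,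
    wedge_smul_right, wedge_swap, wedge_sub_right, wedge_self_eq_zero, sub_zero,
    neg_mul_neg, one_mul] at this

/-- In the affine coordinates `(l, m)` with origin in the pole, the tangent equations at `b` and `a`
are proportional to `l` and `m`. -/
theorem exists_coord (x : Plane) : ∃ l m : ℝ, x - Q = l • (a - Q) + m • (b - Q) ∧
    wedge T (x - b) = l * wedge T (a - b) ∧ wedge S (x - a) = m * wedge S (b - a) := by
  obtain ⟨l, m, hlm⟩ := exists_combination (h.wedge_coord_ne hc) (x - Q)
  refine ⟨l, m, hlm, ?_, ?_⟩
  · rw [show x - b = (x - Q) + (Q - b) by abel, hlm,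
      show l • (a - Q) + m • (b - Q) + (Q - b) = l • (a - b) + (1 - l - m) • (Q - b) by module,
      wedge_add_right, wedge_smul_right, wedge_smul_right, h.right_wedge, mul_zero, add_zero]
  · rw [show x - a = (x - Q) + (Q - a) by abel, hlm,
      show l • (a - Q) + m • (b - Q) + (Q - a) = m • (b - a) + (1 - l - m) • (Q - a) by module,
      wedge_add_right, wedge_smul_right, wedge_smul_right, h.left_wedge, mul_zero, add_zero]

/-- No third tangent passes through the pole. -/
theorem wedge_deriv_pole_ne {t : ℝ} (hta : c t ≠ a) (htb : c t ≠ b) :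
    wedge (deriv c t) (Q - c t) ≠ 0 := by
  intro h0
  obtain ⟨σ, -, hV⟩ := hc.exists_isTangentVec t
  obtain ⟨l, m, hlm, hl, hm⟩ := h.exists_coord hc (c t)
  have hfr := hc.isCompact.isClosed.frontier_subset
  have hl0 : 0 < l := pos_of_mul_pos_left
    (hl ▸ h.right_tangent _ (hc.mem t) htb) (h.symm.left_pos hc.isCompact).le
  have hm0 : 0 < m := pos_of_mul_pos_left
    (hm ▸ h.left_tangent _ (hc.mem t) hta) (h.left_pos hc.isCompact).le
  have h1 := hV a (hfr h.left_mem) hta.symm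
  have h2 := hV b (hfr h.right_mem) htb.symm
  have hV0 : wedge (σ • deriv c t) (Q - c t) = 0 := by rw [wedge_smul_left, h0, mul_zero]
  rw [show a - c t = (a - Q) + (Q - c t) by abel, wedge_add_right, hV0, add_zero] at h1
  rw [show b - c t = (b - Q) + (Q - c t) by abel, wedge_add_right, hV0, add_zero] at h2
  have h3 : wedge (σ • deriv c t) (c t - Q) = 0 := by
    rw [show c t - Q = (-1 : ℝ) • (Q - c t) by module, wedge_smul_right, hV0, mul_zero]
  rw [hlm, wedge_add_right, wedge_smul_right, wedge_smul_right] at h3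
  have := mul_pos hl0 h1
  have := mul_pos hm0 h2
  linarith

/-- At a point of nonzero curvature the logarithmic derivative of `κ² / (αβ)` along the curve
vanishes. The chord through that point `c t` and `Q` has a pole `P` on the line `ab`, and the
harmonic property of this chord, applied to the line `ab` through `P`, is the assertion. -/
theorem log_deriv_eq_zero
    (hrot : ∀ P Q : Plane, P ≠ Q → (line[ℝ, P, Q] : Set Plane) ∩ frontier K = ∅ →
      IsConjugateToRotation (pencilComp (frontier K) P Q))
    {t : ℝ} (hta : c t ≠ a) (htb : c t ≠ b)
    (hflat : wedge (deriv c t) (deriv (deriv c) t) ≠ 0) (hpar : wedge (b - a) (deriv c t) ≠ 0) :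
    2 * wedge (b - a) (deriv c t) * (wedge T (c t - b) * wedge S (c t - a)) -
      wedge (b - a) (c t - a) * (wedge T (deriv c t) * wedge S (c t - a) +
        wedge T (c t - b) * wedge S (deriv c t)) = 0 := by
  have hK := hc.isCompact
  have hs := hc.strictConvex
  have hfr := hK.isClosed.frontier_subset
  set x := c t with hx
  set v := deriv c t with hv
  have hκx : wedge (b - a) (x - a) ≠ 0 := fun h0 => by
    rcases eq_or_eq_of_wedge_eq_zero hK hs h.left_mem h.right_mem (hc.mem_frontier t) h.ne h0
      with h1 | h1
    · exact hta h1
    · exact htb h1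
  -- `P` is the point in which the tangent at `x` meets the line `ab`.
  set s : ℝ := -wedge (b - a) (x - a) / wedge (b - a) v with hs_def
  have hs0 : s ≠ 0 := div_ne_zero (neg_ne_zero.2 hκx) hpar
  have hsv : s * wedge (b - a) v = -wedge (b - a) (x - a) := div_mul_cancel₀ _ hpar
  set P : Plane := x + s • v with hP
  have hPab : wedge (b - a) (P - a) = 0 := by
    rw [hP, add_sub_right_comm, wedge_add_right, wedge_smul_right, hsv, add_neg_cancel]
  obtain ⟨σ, hσ, hV⟩ := hc.exists_isTangentVec t
  have hσ0 : σ ≠ 0 := by rcases hσ with rfl | rfl <;> norm_num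
  have hVP : wedge (σ • v) (P - x) = 0 := by
    rw [hP, add_sub_cancel_left, wedge_smul_left, wedge_smul_right, wedge_self_eq_zero, mul_zero,
      mul_zero]
  have hPK : P ∉ K := by
    intro hPK
    have : P = x := by_contra fun hne => (hV P hPK hne).ne' hVP
    rw [this] at hPab
    exact hκx hPab
  obtain ⟨-, -, hPa, hcomm⟩ := h.pencilMap_comm hK hs hrot hPK hPab
  set X : frontier K := ⟨x, hc.mem_frontier t⟩ with hX
  have hPX : pencilMap (frontier K) P X = X := pencilMap_fixed_of_isTangentVec hK hV hVP
  set d := pencilMap (frontier K) Q X with hd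
  have hinv := pencilMap_involutive hK hs h.notMem
  have hdX : d ≠ X := fun he =>
    h.wedge_deriv_pole_ne hc hta htb (hc.wedge_eq_zero_of_fixed h.notMem (x := X) rfl he)
  have hPd : pencilMap (frontier K) P d = d := by rw [hd, hcomm, hPX]
  obtain ⟨t', ht'⟩ : (d : Plane) ∈ Set.range c := by rw [hc.range_eq]; exact d.2
  obtain ⟨σ', -, hV'⟩ := hc.exists_isTangentVec t'
  rw [ht'] at hV'
  set W := σ' • deriv c t' with hW
  have hWP : wedge W (P - d) = 0 := by
    rw [hW, wedge_smul_left, hc.wedge_eq_zero_of_fixed hPK ht' hPd, mul_zero]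
  have hpole : IsPole K x d P (σ • v) W :=
    ⟨hc.mem_frontier t, d.2, fun he => hdX (Subtype.ext he.symm), hV, hV', hVP, hWP⟩
  have had : a ≠ d := by
    intro he
    have h1 : d = ⟨a, h.left_mem⟩ := Subtype.ext he.symm
    have h2 : X = ⟨a, h.left_mem⟩ := by
      rw [← hinv X, ← hd, h1]
      exact pencilMap_fixed_of_isTangentVec hK h.left_tangent h.left_wedge
    exact hta (congrArg Subtype.val h2)
  have harm := hpole.harmonic hc rfl hσ0 rfl hflat hrot (x := ⟨a, h.left_mem⟩)
    (fun h0 => by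
      rcases eq_or_eq_of_wedge_eq_zero hK hs hpole.left_mem hpole.right_mem h.left_mem hpole.ne h0
        with h1 | h1
      · exact hta h1.symm
      · exact had h1)
    hPa (fun he => h.ne (congrArg Subtype.val he).symm)
  simp only at harm
  obtain ⟨ρ, hρ⟩ := exists_smul_of_wedge_eq_zero (sub_ne_zero.2 h.ne.symm) hPab
  have hPeq : P = a + ρ • (b - a) := by rw [← hρ]; abel
  have eb : wedge W (b - d) = (1 - ρ) * wedge W (b - a) := by
    rw [show b - (d : Plane) = (1 - ρ) • (b - a) + (P - d) by rw [hPeq]; module, wedge_add_right,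
      hWP, wedge_smul_right, add_zero]
  have ea : wedge W (a - d) = -ρ * wedge W (b - a) := by
    rw [show a - (d : Plane) = (-ρ) • (b - a) + (P - d) by rw [hPeq]; module, wedge_add_right,
      hWP, wedge_smul_right, add_zero]
  have hq : wedge W (b - a) ≠ 0 := by
    intro h0
    have := hV' a (hfr h.left_mem) had
    rw [ea, h0, mul_zero] at this
    exact lt_irrefl _ this
  obtain ⟨l, hl⟩ := mem_line_iff_exists.1 (pencilMap_mem_line (P := Q) X)
  have hdx : (d : Plane) - x = (1 - l) • (Q - x) := by rw [hd, hl]; module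
  have hl1 : 1 - l ≠ 0 := by
    intro h0
    rw [h0, zero_smul, sub_eq_zero] at hdx
    exact hdX (Subtype.ext hdx)
  obtain ⟨i, j, hij, hi, hj⟩ := h.exists_coord hc x
  have hD := h.wedge_coord_ne hc
  have w1 : wedge (Q - x) (a - x) = j * wedge (a - Q) (b - Q) := by
    rw [show a - x = (a - Q) + (Q - x) by abel, wedge_add_right, wedge_self_eq_zero,
      show Q - x = (-1 : ℝ) • (x - Q) by module, hij, wedge_smul_left, wedge_swap, wedge_add_right,
      wedge_smul_right, wedge_smul_right, wedge_self_eq_zero]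
    ring
  have w2 : wedge (Q - x) (b - x) = -i * wedge (a - Q) (b - Q) := by
    rw [show b - x = (b - Q) + (Q - x) by abel, wedge_add_right, wedge_self_eq_zero,
      show Q - x = (-1 : ℝ) • (x - Q) by module, hij, wedge_smul_left,
      wedge_swap (i • (a - Q) + j • (b - Q)), wedge_add_right,
      wedge_smul_right, wedge_smul_right, wedge_self_eq_zero, wedge_swap (b - Q)]
    ring
  -- The lines `Qx` and `Px` divide the segment `ab` harmonically.
  have key : (1 - ρ) * j + ρ * i = 0 := by
    rw [hdx, wedge_smul_left (Q - x), wedge_smul_left (Q - x), eb, ea, w1, w2] at harm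
    have hne : (1 - l) * wedge (a - Q) (b - Q) * wedge W (b - a) ≠ 0 :=
      mul_ne_zero (mul_ne_zero hl1 hD) hq
    apply mul_left_cancel₀ hne
    rw [mul_zero]
    linear_combination harm
  have hTv : s * wedge T v = (1 - ρ) * wedge T (a - b) - wedge T (x - b) := by
    rw [← wedge_smul_right, ← wedge_smul_right, ← wedge_sub_right]
    congr 1
    have : s • v = P - x := by rw [hP]; abel
    rw [this, hPeq]; module
  have hSv : s * wedge S v = ρ * wedge S (b - a) - wedge S (x - a) := by
    rw [← wedge_smul_right, ← wedge_smul_right, ← wedge_sub_right]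
    congr 1
    have : s • v = P - x := by rw [hP]; abel
    rw [this, hPeq]; module
  apply mul_left_cancel₀ hs0
  rw [mul_zero]
  rw [hi] at hTv ⊢
  rw [hj] at hSv ⊢
  linear_combination
    2 * (i * wedge T (a - b) * (j * wedge S (b - a))) * hsv -
    wedge (b - a) (x - a) * (j * wedge S (b - a)) * hTv -
    wedge (b - a) (x - a) * (i * wedge T (a - b)) * hSv -
    wedge (b - a) (x - a) * wedge T (a - b) * wedge S (b - a) * key

/-- An arc which starts or ends at the contact point `a` of nonzero curvature lies on a conic. -/
theorem quotient_eq_on_arc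
    (hrot : ∀ P Q : Plane, P ≠ Q → (line[ℝ, P, Q] : Set Plane) ∩ frontier K = ∅ →
      IsConjugateToRotation (pencilComp (frontier K) P Q))
    {p q t L : ℝ} (hat : c t = a) (hne : ∀ s ∈ Set.Ioo p q, c s ≠ a ∧ c s ≠ b)
    (hcl : t ∈ closure (Set.Ioo p q))
    (hL : Filter.Tendsto (fun s => wedge (b - a) (c s - a) ^ 2 /
      (wedge T (c s - b) * wedge S (c s - a))) (nhdsWithin t {t}ᶜ) (nhds L))
    {s : ℝ} (hs : s ∈ Set.Ioo p q) :
    wedge (b - a) (c s - a) ^ 2 = L * (wedge T (c s - b) * wedge S (c s - a)) := by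
  set N : ℝ → ℝ := fun t =>
    2 * wedge (b - a) (deriv c t - 0) * (wedge T (c t - b) * wedge S (c t - a)) -
      wedge (b - a) (c t - a) * (wedge T (deriv c t - 0) * wedge S (c t - a) +
        wedge T (c t - b) * wedge S (deriv c t - 0)) with hN
  have h1 : ∀ u v : Plane, Continuous fun s => wedge u (c s - v) := fun u v =>
    (continuous_wedge u v).comp hc.contDiff.continuous
  have h2 : ∀ u : Plane, Continuous fun s => wedge u (deriv c s - 0) := fun u =>
    (continuous_wedge u 0).comp hc.continuous_deriv
  have hNc : Continuous N :=
    ((continuous_const.mul (h2 _)).mul ((h1 _ _).mul (h1 _ _))).sub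
      ((h1 _ _).mul (((h2 _).mul (h1 _ _)).add ((h1 _ _).mul (h2 _))))
  have hN0 : ∀ r ∈ Set.Ioo p q, N r = 0 := by
    intro r hr
    by_contra hNr
    obtain ⟨z, hz, hzf, hzp⟩ := hc.exists_nonflat (sub_ne_zero.2 h.ne.symm)
      (isOpen_Ioo.inter (isOpen_ne_fun hNc continuous_const)) ⟨r, hr, hNr⟩
    apply hz.2
    simp only [hN, sub_zero]
    exact h.log_deriv_eq_zero hc hrot (hne z hz.1).1 (hne z hz.1).2 hzf hzp
  have hpos : ∀ r ∈ Set.Ioo p q, wedge T (c r - b) * wedge S (c r - a) ≠ 0 := fun r hr =>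
    (mul_pos (h.right_tangent _ (hc.mem r) (hne r hr).2)
      (h.left_tangent _ (hc.mem r) (hne r hr).1)).ne'
  have hder : ∀ r ∈ Set.Ioo p q, HasDerivAt (fun s => wedge (b - a) (c s - a) ^ 2 /
      (wedge T (c s - b) * wedge S (c s - a))) 0 r := by
    intro r hr
    have d := hc.hasDerivAt r
    refine HasDerivAt.congr_deriv (((hasDerivAt_wedge d (b - a) a).fun_pow 2).fun_div
      ((hasDerivAt_wedge d T b).fun_mul (hasDerivAt_wedge d S a)) (hpos r hr)) ?_
    rw [div_eq_zero_iff]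
    left
    have := hN0 r hr
    simp only [hN, sub_zero] at this
    push_cast
    linear_combination wedge (b - a) (c r - a) * this
  have hconst : ∀ r ∈ Set.Ioo p q, wedge (b - a) (c r - a) ^ 2 /
      (wedge T (c r - b) * wedge S (c r - a)) = wedge (b - a) (c s - a) ^ 2 /
      (wedge T (c s - b) * wedge S (c s - a)) := fun r hr =>
    isOpen_Ioo.is_const_of_deriv_eq_zero isPreconnected_Ioo
      (fun z hz => (hder z hz).differentiableAt.differentiableWithinAt)
      (fun z hz => (hder z hz).deriv) hr hs
  have : (nhdsWithin t (Set.Ioo p q)).NeBot := mem_closure_iff_nhdsWithin_neBot.1 hcl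
  have hle : nhdsWithin t (Set.Ioo p q) ≤ nhdsWithin t {t}ᶜ :=
    nhdsWithin_mono t fun r hr he => (hne r hr).1 (by rw [Set.mem_singleton_iff.1 he, hat])
  have hval : wedge (b - a) (c s - a) ^ 2 / (wedge T (c s - b) * wedge S (c s - a)) = L :=
    tendsto_nhds_unique (tendsto_const_nhds.congr' (by
      filter_upwards [self_mem_nhdsWithin] with r hr
      exact (hconst r hr).symm)) (hL.mono_left hle)
  rw [← hval, div_mul_cancel₀ _ (hpos s hs)]

end IsPole

/-- The curve lies on the conic `κ² = L αβ`, which touches it at the ends of a chord `ab`. -/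
theorem IsOvalParam.exists_conic {K : Set Plane} {c : ℝ → Plane} (hc : IsOvalParam K c)
    (hrot : ∀ P Q : Plane, P ≠ Q → (line[ℝ, P, Q] : Set Plane) ∩ frontier K = ∅ →
      IsConjugateToRotation (pencilComp (frontier K) P Q)) :
    ∃ (a b Q S T : Plane) (L : ℝ), IsPole K a b Q S T ∧ ∀ X ∈ frontier K,
      wedge (b - a) (X - a) ^ 2 = L * (wedge T (X - b) * wedge S (X - a)) := by
  obtain ⟨t, -, ht⟩ := hc.exists_wedge_deriv_deriv_ne (zero_lt_one' ℝ)
  obtain ⟨u, hu, hpar⟩ := hc.exists_wedge_deriv_ne (hc.deriv_ne t) (lt_add_one t)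
  obtain ⟨σ, hσ, hS⟩ := hc.exists_isTangentVec t
  obtain ⟨τ, hτ, hT⟩ := hc.exists_isTangentVec u
  have hσ0 : σ ≠ 0 := by rcases hσ with rfl | rfl <;> norm_num
  have hτ0 : τ ≠ 0 := by rcases hτ with rfl | rfl <;> norm_num
  have huniq : ∀ r s, r ∈ Set.Ioo (u - 1) u → s ∈ Set.Icc (u - 1) u → c r = c s → r = s := by
    intro r s hr hs he
    refine hc.eq_of_near he ?_
    rw [abs_lt]
    constructor <;> linarith [hr.1, hr.2, hs.1, hs.2]
  have htI : t ∈ Set.Ioo (u - 1) u := ⟨by linarith [hu.2], hu.1⟩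
  set S := σ • deriv c t with hSdef
  set T := τ • deriv c u with hTdef
  have hTS : wedge T S ≠ 0 := by
    rw [hSdef, hTdef, wedge_smul_left, wedge_smul_right]
    exact mul_ne_zero hτ0 (mul_ne_zero hσ0 (by rwa [wedge_swap, neg_ne_zero]))
  set Q : Plane := c t + (-wedge T (c t - c u) / wedge T S) • S with hQ
  have hpole : IsPole K (c t) (c u) Q S T := by
    refine ⟨hc.mem_frontier t, hc.mem_frontier u, fun he => ?_, hS, hT, ?_, ?_⟩
    · exact htI.2.ne (huniq t u htI ⟨by linarith, le_rfl⟩ he)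
    · rw [hQ, add_sub_cancel_left, wedge_smul_right, wedge_self_eq_zero, mul_zero]
    · rw [hQ, add_sub_right_comm, wedge_add_right, wedge_smul_right, div_mul_cancel₀ _ hTS,
        add_neg_cancel]
  obtain ⟨L, -, hL⟩ := hpole.tendsto_quotient hc rfl hσ0 hSdef ht
  refine ⟨c t, c u, Q, S, T, L, hpole, fun X hX => ?_⟩
  obtain ⟨r, rfl⟩ : X ∈ Set.range c := by rw [hc.range_eq]; exact hX
  obtain ⟨s, hs, hrs⟩ := hc.periodic.exists_mem_Ico one_pos r (u - 1)
  rw [sub_add_cancel] at hs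
  rw [hrs]
  have hcu : c (u - 1) = c u := hc.periodic.sub_eq u
  have hne : ∀ r ∈ Set.Ioo (u - 1) u, r ≠ t → c r ≠ c t ∧ c r ≠ c u := by
    intro r hr hrt
    refine ⟨fun he => hrt (huniq r t hr ⟨htI.1.le, htI.2.le⟩ he), fun he => ?_⟩
    exact hr.2.ne (huniq r u hr ⟨by linarith, le_rfl⟩ he)
  rcases eq_or_lt_of_le hs.1 with h1 | h1
  · rw [← h1, hcu, wedge_self_eq_zero, sub_self]
    simp [wedge]
  rcases lt_trichotomy s t with h2 | rfl | h2
  · refine hpole.quotient_eq_on_arc hc hrot (p := u - 1) (q := t) rfl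
      (fun r hr => hne r ⟨hr.1, hr.2.trans htI.2⟩ hr.2.ne) ?_ hL ⟨h1, h2⟩
    rw [closure_Ioo htI.1.ne]
    exact ⟨htI.1.le, le_rfl⟩
  · simp [wedge]
  · refine hpole.quotient_eq_on_arc hc hrot (p := t) (q := u) rfl
      (fun r hr => hne r ⟨htI.1.trans hr.1, hr.2⟩ hr.1.ne') ?_ hL ⟨h2, hs.2⟩
    rw [closure_Ioo htI.2.ne]
    exact ⟨le_rfl, htI.2.le⟩

/-! ### From a conic to an ellipse -/

/-- A compact set with interior points whose boundary lies on the unit circle has the whole circle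
as its boundary: every ray from an interior point meets the boundary. -/
theorem frontier_eq_sphere_of_subset {K : Set Plane} (hK : IsCompact K)
    (hne : (interior K).Nonempty) (hsub : frontier K ⊆ Metric.sphere (0 : Plane) 1) :
    frontier K = Metric.sphere (0 : Plane) 1 := by
  have hball := strictConvex_closedBall ℝ (0 : Plane) 1
  have hfr : frontier (Metric.closedBall (0 : Plane) 1) = Metric.sphere 0 1 :=
    frontier_closedBall 0 one_ne_zero
  have hin : ∀ {x : Plane}, x ∈ Metric.sphere (0 : Plane) 1 → x ∈ Metric.closedBall (0 : Plane) 1 :=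
    fun hx => Metric.sphere_subset_closedBall hx
  refine hsub.antisymm fun e he => ?_
  obtain ⟨z, hz⟩ := hne
  -- `z` lies on a chord of the unit circle, and so inside the disc.
  have hzb : z ∈ Metric.closedBall (0 : Plane) 1 := by
    have hv : e ≠ 0 := by rintro rfl; simp at he
    obtain ⟨s, hs, h1⟩ := exists_pos_mem_frontier hK hz hv
    obtain ⟨r, hr, h2⟩ := exists_pos_mem_frontier hK hz (neg_ne_zero.2 hv)
    have := hball.convex (hin (hsub h1)) (hin (hsub h2))
      (div_nonneg hr.le (by positivity : 0 ≤ r + s))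
      (div_nonneg hs.le (by positivity : 0 ≤ r + s))
      (by field_simp)
    convert this using 1
    rw [show (r / (r + s)) • (z + s • e) + (s / (r + s)) • (z + r • -e) =
      (r / (r + s) + s / (r + s)) • z + (r / (r + s) * s - s / (r + s) * r) • e by module,
      show r / (r + s) + s / (r + s) = 1 by field_simp,
      show r / (r + s) * s - s / (r + s) * r = 0 by ring]
    module
  have hez : e - z ≠ 0 := by
    intro h0
    rw [sub_eq_zero] at h0
    obtain ⟨s, hs, h1⟩ := exists_pos_mem_frontier hK hz (v := e) (by rintro rfl; simp at he)
    obtain ⟨r, hr, h2⟩ := exists_pos_mem_frontier hK hz (v := -e)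
      (neg_ne_zero.2 (by rintro rfl; simp at he))
    have h3 := hsub h1
    rw [← h0, mem_sphere_zero_iff_norm, show e + s • e = (1 + s) • e by module, norm_smul,
      mem_sphere_zero_iff_norm.1 he, mul_one, Real.norm_of_nonneg (by linarith)] at h3
    linarith
  obtain ⟨s, hs, hy⟩ := exists_pos_mem_frontier hK hz hez
  have hys := hsub hy
  have e0 : z + (0 : ℝ) • (e - z) = z := by module
  have e1 : z + (1 : ℝ) • (e - z) = e := by module
  rcases lt_trichotomy s 1 with h1 | rfl | h1
  · exact (false_of_three_params hball hez hs h1 (e0.symm ▸ hzb) (e1.symm ▸ hin he)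
      (hfr.symm ▸ hys)).elim
  · rwa [e1] at hy
  · exact (false_of_three_params hball hez one_pos h1 (e0.symm ▸ hzb) (hin hys)
      (by rw [hfr, e1]; exact he)).elim

theorem exists_affineEquiv (o : Plane) {u v : Plane} (h : wedge u v ≠ 0) :
    ∃ A : Plane ≃ᵃ[ℝ] Plane, ∀ X, A X = o + (X 0 • u + X 1 • v) := by
  let M : Plane →ₗ[ℝ] Plane :=
    { toFun := fun X => X 0 • u + X 1 • v
      map_add' := fun X Y => by simp only [PiLp.add_apply]; module
      map_smul' := fun r X => by
        simp only [PiLp.smul_apply, smul_eq_mul, RingHom.id_apply]; module }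
  have hM : Function.Injective M := by
    rw [injective_iff_map_eq_zero]
    intro X hX
    have hX' : X 0 • u + X 1 • v = 0 := hX
    have h1 := congrArg (wedge u) hX'
    have h2 := congrArg (wedge v) hX'
    rw [wedge_add_right, wedge_smul_right, wedge_smul_right, wedge_self_eq_zero,
      show wedge u 0 = 0 by simp [wedge], mul_zero, zero_add] at h1
    rw [wedge_add_right, wedge_smul_right, wedge_smul_right, wedge_self_eq_zero,
      show wedge v 0 = 0 by simp [wedge], mul_zero, add_zero, wedge_swap] at h2
    exact plane_ext (by simpa using (mul_eq_zero.1 h2).resolve_right (neg_ne_zero.2 h))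
      (by simpa using (mul_eq_zero.1 h1).resolve_right h)
  refine ⟨(LinearEquiv.ofInjectiveEndo M hM).toAffineEquiv.trans
    (AffineEquiv.constVAdd ℝ Plane o), fun X => ?_⟩
  rfl

/-- A curve on the conic `κ² = L αβ` of a chord `ab` with pole `Q` is an ellipse. -/
theorem IsPole.isEllipse {K : Set Plane} {a b Q S T : Plane} (h : IsPole K a b Q S T)
    {c : ℝ → Plane} (hc : IsOvalParam K c) {L : ℝ} (hL : ∀ X ∈ frontier K,
      wedge (b - a) (X - a) ^ 2 = L * (wedge T (X - b) * wedge S (X - a))) :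
    IsEllipse (frontier K) := by
  have hK := hc.isCompact
  have hfr := hK.isClosed.frontier_subset
  set A := a - Q with hA
  set B := b - Q with hB
  have hκQ := h.wedge_pole_ne hK
  set lam : ℝ := L * wedge T (a - b) * wedge S (b - a) / wedge (b - a) (Q - a) ^ 2 with hlam
  -- The equation of the conic in the affine coordinates with origin `Q` and basis `a - Q`, `b - Q`.
  have hconic : ∀ l m : ℝ, Q + (l • A + m • B) ∈ frontier K → (1 - l - m) ^ 2 = lam * (l * m) := by
    intro l m hX
    have h1 := hL _ hX
    rw [show Q + (l • A + m • B) - a = (1 - l - m) • (Q - a) + m • (b - a) by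
        rw [hA, hB]; module,
      show Q + (l • A + m • B) - b = (1 - l - m) • (Q - b) + l • (a - b) by
        rw [hA, hB]; module] at h1
    simp only [wedge_add_right, wedge_smul_right, h.left_wedge, h.right_wedge,
      wedge_self_eq_zero, mul_zero, add_zero, zero_add] at h1
    rw [hlam]
    field_simp
    linear_combination h1
  have hmid : a + (1 / 2 : ℝ) • (b - a) ∈ interior K :=
    mem_interior_of_between hc.strictConvex (hfr h.left_mem) (hfr h.right_mem) h.ne
      (by norm_num) (by norm_num)
  have hdir : a + (1 / 2 : ℝ) • (b - a) - Q ≠ 0 :=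
    sub_ne_zero.2 fun he => h.notMem (he ▸ interior_subset hmid)
  -- The ray from `Q` through the midpoint of `ab` meets the curve beyond that midpoint. This
  -- excludes parabolas and hyperbolas.
  obtain ⟨τ, hτ, hτK⟩ := exists_pos_mem_frontier hK hmid hdir
  have hlamτ := hconic ((1 + τ) / 2) ((1 + τ) / 2) (by
    convert hτK using 1
    rw [hA, hB]; module)
  set k := τ / (1 + τ) with hk
  have hk0 : 0 < k := by positivity
  have hk1 : k < 1 := by rw [hk, div_lt_one (by positivity)]; linarith
  have hlamk : lam = 4 * k ^ 2 := by
    rw [hk]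
    field_simp
    linear_combination -4 * hlamτ
  set r := Real.sqrt (1 - k ^ 2) with hr
  have hr2 : r ^ 2 = 1 - k ^ 2 := Real.sq_sqrt (by nlinarith)
  have hr0 : 0 < r := Real.sqrt_pos.2 (by nlinarith)
  -- `E` maps the unit circle to the conic: its centre is the centre of the conic, and its axes are
  -- the conjugate diameters in the directions `A + B` and `A - B`.
  obtain ⟨E, hE⟩ := exists_affineEquiv (Q + (1 / (2 * r ^ 2)) • (A + B))
    (u := (k / (2 * r ^ 2)) • (A + B)) (v := (1 / (2 * r)) • (A - B)) (by
      have hD := h.wedge_coord_ne hc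
      have : wedge (A + B) (A - B) = -2 * wedge A B := by
        simp only [wedge, PiLp.add_apply, PiLp.sub_apply]; ring
      rw [wedge_smul_left, wedge_smul_right, this]
      exact mul_ne_zero (by positivity) (mul_ne_zero (by positivity)
        (mul_ne_zero (by norm_num) hD)))
  have hsub : ∀ X : Plane, E X ∈ frontier K → X ∈ Metric.sphere (0 : Plane) 1 := by
    intro X hX
    have h1 := hconic ((1 + k * X 0) / (2 * r ^ 2) + X 1 / (2 * r))
      ((1 + k * X 0) / (2 * r ^ 2) - X 1 / (2 * r)) (by
        convert hX using 1
        rw [hE]; module)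
    rw [EuclideanSpace.sphere_zero_eq 1 zero_le_one]
    simp only [Fin.sum_univ_two, Set.mem_ofPred_eq, one_pow]
    rw [hlamk] at h1
    have h2 : (k ^ 2 * r ^ 2) * (X 0 ^ 2 + X 1 ^ 2 - 1) = 0 := by
      have e1 : (1 + k * X 0) / (2 * r ^ 2) * (2 * r ^ 2) = 1 + k * X 0 :=
        div_mul_cancel₀ _ (by positivity)
      have e2 : X 1 / (2 * r) * (2 * r) = X 1 := div_mul_cancel₀ _ (by positivity)
      generalize (1 + k * X 0) / (2 * r ^ 2) = p at e1 h1
      generalize X 1 / (2 * r) = q at e2 h1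
      have h3 : (r ^ 2 - (1 + k * X 0)) ^ 2 =
          k ^ 2 * ((1 + k * X 0) ^ 2 - r ^ 2 * X 1 ^ 2) := by
        rw [← e1, ← e2]
        linear_combination r ^ 4 * h1
      rw [hr2] at h3 ⊢
      linear_combination h3
    have h3 := (mul_eq_zero.1 h2).resolve_left (by positivity)
    linarith
  set H : Plane ≃ₜ Plane := (AffineEquiv.toContinuousAffineEquiv E).toHomeomorph
  have hpre : H ⁻¹' frontier K = frontier (H ⁻¹' K) := H.preimage_frontier K
  have key := frontier_eq_sphere_of_subset (K := H ⁻¹' K)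
    (H.isCompact_preimage.2 hK)
    (by rw [← H.preimage_interior]; exact hc.nonempty.preimage H.surjective)
    (by rw [← hpre]; exact fun X hX => hsub X hX)
  refine ⟨E, ?_⟩
  rw [← key, ← hpre]
  exact (Set.image_preimage_eq _ H.surjective).symm

theorem theorem2 (γ : Set Plane) (hγ : IsOval γ)
    (h : ∀ P Q : Plane, P ≠ Q → (line[ℝ, P, Q] : Set Plane) ∩ γ = ∅ →
      IsConjugateToRotation (pencilComp γ P Q)) :
    IsEllipse γ := by
  obtain ⟨⟨c, hsmooth, hper, hinj, hreg, hrange⟩, K, hK, hs, hne, rfl⟩ := hγ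
  have hc : IsOvalParam K c := by
    refine ⟨hK, hs, hne, hsmooth, hper, fun s t hst => ?_, hreg, hrange⟩
    have hf : ∀ s, c (Int.fract s) = c s := fun s => by
      have := hper.sub_int_mul_eq (x := s) ⌊s⌋
      rwa [mul_one] at this
    have hfr : Int.fract s = Int.fract t := hinj ⟨Int.fract_nonneg s, Int.fract_lt_one s⟩
      ⟨Int.fract_nonneg t, Int.fract_lt_one t⟩ (by rw [hf, hf, hst])
    exact Int.fract_eq_fract.1 hfr
  obtain ⟨a, b, Q, S, T, L, hpole, hL⟩ := hc.exists_conic h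
  exact hpole.isEllipse hc hL
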